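/- All topological spaces are Hausdorff, and for a compact space $X$, $C(X)$ denotes the Banach algebra of continuous functions $X\to\mathbb{C}$ with the supremum norm $\|\cdot\|$. For $\mathcal{E}\subseteq C(X)$ let $x\sim_{\mathcal{E}}y$ mean that $f(x)=f(y)$ for all $f\in\mathcal{E}$; the equivalence classes of $\sim_{\mathcal{E}}$ are called the fibres of $\mathcal{E}$. A space is scattered if each of its non-empty subsets has a (relatively) isolated point. A compact space $X$ is nice if there is a countable $\mathcal{E}\subseteq C(X)$ such that 1. every fibre of $\mathcal{E}$ is scattered, and 2. for every $f\in C(X)$, $f$ is constant on all but at most countably many fibres of $\mathcal{E}$. If $\mathcal{A}\subseteq C(X)$ is a subalgebra that separates points and contains the constant functions, a closed set $F\subseteq X$ is a boundary for $\mathcal{A}$ if $\sup_{x\in F}|f(x)|=\|f\|$ for all $f\in\mathcal{A}$, and the Šilov boundary $\check{S}(\mathcal{A})$ is the smallest boundary for $\mathcal{A}$. A compact space $H$ is removable if $\check{S}(\mathcal{A})\subseteq X\setminus U$ whenever $X$ is a compact space, $U\subsetneq X$ is an open set whose closure $\overline{U}$ is homeomorphic to a subspace of $H$, and $\mathcal{A}\subseteq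 C(X)$ is a norm-closed subalgebra that separates points, contains the constant functions, and whose only idempotents are the constant functions $0$ and $1$. Lemma. Let $H$ be a compact space that is nice and has no subspace homeomorphic to the Cantor set. Then $H$ is removable. -/

import Mathlib

namespace FunctionAlgebra

/-- A set `S` in a topological space is scattered iff every non-empty subset of `S` has a
relatively isolated point. -/
def IsScattered {X : Type*} [TopologicalSpace X] (S : Set X) : Prop :=
  ∀ T ⊆ S, T.Nonempty → ∃ x ∈ T, ∃ U : Set X, IsOpen U ∧ U ∩ T = {x}

/-- `X` contains a Cantor subset: a subspace homeomorphic to the Cantor set. -/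
def ContainsCantorSubset (X : Type*) [TopologicalSpace X] : Prop :=
  ∃ K : Set X, Nonempty (K ≃ₜ cantorSet)

/-- The equivalence relation `x ∼ y` iff `f x = f y` for all `f ∈ E`. Its classes are the
fibres of the family `E`. -/
def fibreSetoid {X : Type*} [TopologicalSpace X] (E : Set C(X, ℂ)) : Setoid X where
  r x y := ∀ f ∈ E, f x = f y
  iseqv :=
    { refl := fun _ _ _ => rfl
      symm := fun h f hf => (h f hf).symm
      trans := fun h₁ h₂ f hf => (h₁ f hf).trans (h₂ f hf) }

/-- A family `E` of continuous functions is nice iff all its fibres are scattered and every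
continuous function has a one-point image on all but countably many of them. -/
structure IsNiceFamily {X : Type*} [TopologicalSpace X] (E : Set C(X, ℂ)) : Prop where
  scattered : ∀ s ∈ (fibreSetoid E).classes, IsScattered s
  constant : ∀ f : C(X, ℂ),
    {s : Set X | s ∈ (fibreSetoid E).classes ∧ ¬ ∃ z : ℂ, f '' s = {z}}.Countable

/-- A space is nice iff it has a countable nice family of continuous functions. -/
def IsNice (X : Type*) [TopologicalSpace X] : Prop :=
  ∃ E : Set C(X, ℂ), E.Countable ∧ IsNiceFamily E

section Silov

variable {X : Type*} [TopologicalSpace X] [CompactSpace X]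

/-- The supremum `‖f‖_F` of `|f|` over the set `F` (it is `0` for empty `F`). -/
noncomputable def supNormOn (f : C(X, ℂ)) (F : Set X) : ℝ :=
  ⨆ x : F, ‖f x‖

/-- `F` is a boundary for `A` iff it is closed and `‖f‖_F = ‖f‖` for all `f ∈ A`. -/
def IsBoundary (A : Subalgebra ℂ C(X, ℂ)) (F : Set X) : Prop :=
  IsClosed F ∧ ∀ f ∈ A, supNormOn f F = ‖f‖

/-- The Šilov boundary of `A`. It is the smallest boundary, see `silovBoundary_isLeast`. -/
def silovBoundary (A : Subalgebra ℂ C(X, ℂ)) : Set X :=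
  ⋂₀ {F : Set X | IsBoundary A F}

theorem isBoundary_iff [Nonempty X] (A : Subalgebra ℂ C(X, ℂ)) (F : Set X) :
    IsBoundary A F ↔ IsClosed F ∧ ∀ f ∈ A, ∃ x ∈ F, ‖f x‖ = ‖f‖ := by
  refine and_congr_right fun hF => ⟨fun h f hf => ?_, fun h f hf => ?_⟩
  · have hne : F.Nonempty := by
      by_contra hc
      have h1 := h 1 A.one_mem
      rw [Set.not_nonempty_iff_eq_empty] at hc
      subst hc
      simp [supNormOn] at h1
    obtain ⟨x, hx, hmax⟩ := hF.isCompact.exists_isMaxOn hne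
      (f := fun x => ‖f x‖) (by fun_prop)
    refine ⟨x, hx, le_antisymm (f.norm_coe_le_norm x) ?_⟩
    rw [← h f hf]
    have : Nonempty F := ⟨⟨x, hx⟩⟩
    exact ciSup_le fun y => hmax y.2
  · obtain ⟨x, hx, hxf⟩ := h f hf
    have : Nonempty F := ⟨⟨x, hx⟩⟩
    refine le_antisymm (ciSup_le fun y => f.norm_coe_le_norm y) ?_
    rw [← hxf]
    exact le_ciSup (f := fun y : F => ‖f y‖)
      ⟨‖f‖, by rintro _ ⟨y, rfl⟩; exact f.norm_coe_le_norm y⟩ ⟨x, hx⟩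

theorem exists_basic_nhd (A : Subalgebra ℂ C(X, ℂ)) (hA : A.SeparatesPoints)
    {x : X} {W : Set X} (hW : IsOpen W) (hx : x ∈ W) :
    ∃ t : Set C(X, ℂ), t.Finite ∧ t ⊆ (A : Set C(X, ℂ)) ∧ (∀ f ∈ t, ‖f x‖ < 1) ∧
      {y | ∀ f ∈ t, ‖f y‖ < 1} ⊆ W := by
  have key : ∀ y ∈ Wᶜ, ∃ g ∈ A, ‖g x‖ < 1 ∧ 1 < ‖g y‖ := by
    intro y hy
    have hxy : y ≠ x := fun h => hy (h ▸ hx)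
    obtain ⟨_, ⟨h, hhA, rfl⟩, hne⟩ := hA hxy
    have hne' : h y - h x ≠ 0 := sub_ne_zero.mpr hne
    refine ⟨(2 / (h y - h x)) • (h - algebraMap ℂ C(X, ℂ) (h x)),
      A.smul_mem (A.sub_mem hhA (A.algebraMap_mem _)) _, ?_, ?_⟩
    · simp
    · simp [hne']
  choose! g hgA hgx hgy using key
  obtain ⟨b, hb, hbf, hcov⟩ := hW.isClosed_compl.isCompact.elim_finite_subcover_image
    (b := Wᶜ) (c := fun y => {z | 1 < ‖g y z‖})
    (fun y _ => isOpen_lt continuous_const (by fun_prop))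
    (fun y hy => Set.mem_biUnion hy (hgy y hy))
  refine ⟨g '' b, hbf.image g, ?_, ?_, ?_⟩
  · rintro _ ⟨y, hy, rfl⟩
    exact hgA y (hb hy)
  · rintro _ ⟨y, hy, rfl⟩
    exact hgx y (hb hy)
  · intro z hz
    by_contra hzW
    obtain ⟨y, hy, hzy⟩ := Set.mem_iUnion₂.mp (hcov hzW)
    exact lt_asymm hzy (hz _ ⟨y, hy, rfl⟩)

theorem diff_basic_isBoundary [Nonempty X] (A : Subalgebra ℂ C(X, ℂ))
    {t : Set C(X, ℂ)} (ht : t.Finite) (htA : t ⊆ (A : Set C(X, ℂ)))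
    {E : Set X} (hE : IsBoundary A E) (hEt : Disjoint {y | ∀ f ∈ t, ‖f y‖ < 1} E)
    {F : Set X} (hF : IsBoundary A F) :
    IsBoundary A (F \ {y | ∀ f ∈ t, ‖f y‖ < 1}) := by
  have hVo : IsOpen {y : X | ∀ f ∈ t, ‖f y‖ < 1} := by
    have : {y : X | ∀ f ∈ t, ‖f y‖ < 1} = ⋂ f ∈ t, {y | ‖f y‖ < 1} := by ext; simp
    rw [this]
    exact ht.isOpen_biInter fun f _ => isOpen_lt (by fun_prop) continuous_const
  set V : Set X := {y : X | ∀ f ∈ t, ‖f y‖ < 1} with hV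
  have hFV : IsClosed (F \ V) := hF.1.sdiff hVo
  rw [isBoundary_iff] at hE hF ⊢
  refine ⟨hFV, ?_⟩
  by_contra! hcon
  obtain ⟨f₀, hf₀A, hf₀⟩ := hcon
  have hlt₀ : ∀ x ∈ F \ V, ‖f₀ x‖ < ‖f₀‖ := fun x hx =>
    lt_of_le_of_ne (f₀.norm_coe_le_norm x) (hf₀ x hx)
  have hpos : 0 < ‖f₀‖ := by
    by_contra hc
    have h0 : ‖f₀‖ = 0 := le_antisymm (not_lt.mp hc) (norm_nonneg _)
    obtain ⟨x, hx, -⟩ := hE.2 1 A.one_mem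
    obtain ⟨y, hy, -⟩ := hF.2 1 A.one_mem
    have hall : ∀ z ∈ F, z ∈ V := fun z hz => by
      by_contra hzV
      have := hlt₀ z ⟨hz, hzV⟩
      rw [h0] at this
      exact absurd this (not_lt.mpr (norm_nonneg _))
    have hx' : x ∈ V := by
      intro f hf
      obtain ⟨w, hw, hwf⟩ := hF.2 f (htA hf)
      exact lt_of_le_of_lt (f.norm_coe_le_norm x) (hwf ▸ hall w hw f hf)
    exact Set.disjoint_left.mp hEt hx' hx
  obtain ⟨f, hfA, hf1, hflt⟩ : ∃ f ∈ A, ‖f‖ = 1 ∧ ∀ x ∈ F \ V, ‖f x‖ < 1 := by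
    refine ⟨((‖f₀‖⁻¹ : ℝ) : ℂ) • f₀, A.smul_mem hf₀A _, ?_, fun x hx => ?_⟩
    · rw [norm_smul]; simp [hpos.ne']
    · have := hlt₀ x hx
      rw [ContinuousMap.smul_apply, norm_smul]
      simp only [Complex.norm_real, norm_inv, norm_norm]
      rw [inv_mul_lt_iff₀ hpos]; simpa using this
  obtain ⟨r, hr0, hr1, hr⟩ : ∃ r : ℝ, 0 ≤ r ∧ r < 1 ∧ ∀ x ∈ F \ V, ‖f x‖ ≤ r := by
    rcases (F \ V).eq_empty_or_nonempty with he | hne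
    · exact ⟨0, le_rfl, one_pos, by simp [he]⟩
    · obtain ⟨x, hx, hmax⟩ := hFV.isCompact.exists_isMaxOn hne
        (f := fun x => ‖f x‖) (by fun_prop)
      exact ⟨‖f x‖, norm_nonneg _, hflt x hx, fun y hy => hmax hy⟩
  obtain ⟨C, hC⟩ : ∃ C : ℝ, ∀ g ∈ t, ‖g‖ ≤ C :=
    (ht.image fun g => ‖g‖).bddAbove.imp fun C h g hg => h ⟨g, hg, rfl⟩
  obtain ⟨n, hn⟩ : ∃ n : ℕ, r ^ n * (|C| + 1) < 1 := by
    obtain ⟨n, hn⟩ := exists_pow_lt_of_lt_one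
      (show (0 : ℝ) < (|C| + 1)⁻¹ by positivity) hr1
    exact ⟨n, by rwa [← lt_inv_mul_iff₀' (by positivity), mul_one]⟩
  have hprod : ∀ g ∈ t, ‖f ^ n * g‖ < 1 := by
    intro g hg
    obtain ⟨w, hw, hwg⟩ := hF.2 (f ^ n * g) (A.mul_mem (A.pow_mem hfA n) (htA hg))
    rw [← hwg, ContinuousMap.mul_apply, ContinuousMap.pow_apply, norm_mul, norm_pow]
    by_cases hwV : w ∈ V
    · have h1 : ‖f w‖ ^ n ≤ 1 := pow_le_one₀ (norm_nonneg _) (hf1 ▸ f.norm_coe_le_norm w)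
      exact lt_of_le_of_lt (mul_le_of_le_one_left (norm_nonneg _) h1) (hwV g hg)
    · refine lt_of_le_of_lt (mul_le_mul (pow_le_pow_left₀ (norm_nonneg _) (hr w ⟨hw, hwV⟩) n)
        ?_ (norm_nonneg _) (by positivity)) hn
      exact (g.norm_coe_le_norm w).trans ((hC g hg).trans
        ((le_abs_self C).trans (by linarith)))
  obtain ⟨x, hx, hxf⟩ := hE.2 f hfA
  refine Set.disjoint_left.mp hEt (fun g hg => ?_) hx
  have h := lt_of_le_of_lt ((f ^ n * g).norm_coe_le_norm x) (hprod g hg)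
  rwa [ContinuousMap.mul_apply, ContinuousMap.pow_apply, norm_mul, norm_pow, hxf, hf1, one_pow,
    one_mul] at h

/-- For a point-separating algebra, `silovBoundary A` is the smallest boundary. -/
theorem silovBoundary_isLeast (A : Subalgebra ℂ C(X, ℂ)) (hA : A.SeparatesPoints) :
    IsLeast {F : Set X | IsBoundary A F} (silovBoundary A) := by
  refine ⟨?_, fun F hF => Set.sInter_subset_of_mem hF⟩
  have hcl : IsClosed (silovBoundary A) := isClosed_sInter fun F hF => hF.1
  rcases isEmpty_or_nonempty X with hX | hX
  · refine ⟨hcl, fun f _ => ?_⟩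
    have h0 : f = 0 := by ext x; exact isEmptyElim x
    subst h0
    simp [supNormOn]
  change IsBoundary A (silovBoundary A)
  rw [isBoundary_iff]
  refine ⟨hcl, fun g hg => ?_⟩
  by_contra! hcon
  have hK : IsCompact {x : X | ‖g x‖ = ‖g‖} :=
    (isClosed_eq (by fun_prop) continuous_const).isCompact
  have key : ∀ x ∈ {x : X | ‖g x‖ = ‖g‖}, ∃ V : Set X, IsOpen V ∧ x ∈ V ∧
      ∀ F, IsBoundary A F → IsBoundary A (F \ V) := by
    intro x hx
    have hxS : x ∉ silovBoundary A := fun h => hcon x h hx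
    obtain ⟨E, hE, hxE⟩ : ∃ E, IsBoundary A E ∧ x ∉ E := by
      simpa [silovBoundary] using hxS
    obtain ⟨t, htf, htA, htx, htE⟩ := exists_basic_nhd A hA hE.1.isOpen_compl hxE
    refine ⟨{y | ∀ f ∈ t, ‖f y‖ < 1}, ?_, htx, fun F hF =>
      diff_basic_isBoundary A htf htA hE (Set.disjoint_left.mpr fun y hy => htE hy) hF⟩
    have : {y : X | ∀ f ∈ t, ‖f y‖ < 1} = ⋂ f ∈ t, {y | ‖f y‖ < 1} := by ext; simp
    rw [this]
    exact htf.isOpen_biInter fun f _ => isOpen_lt (by fun_prop) continuous_const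
  choose! V hVo hxV hV using key
  obtain ⟨b, hbK, hbf, hcov⟩ := hK.elim_finite_subcover_image hVo
    (fun x hx => Set.mem_biUnion hx (hxV x hx))
  have huniv : IsBoundary A Set.univ := by
    rw [isBoundary_iff]
    refine ⟨isClosed_univ, fun f _ => ?_⟩
    obtain ⟨x, hx, hmax⟩ := isCompact_univ.exists_isMaxOn Set.univ_nonempty
      (f := fun x => ‖f x‖) (by fun_prop)
    exact ⟨x, hx, le_antisymm (f.norm_coe_le_norm x)
      ((ContinuousMap.norm_le f (norm_nonneg _)).mpr fun y => hmax (Set.mem_univ y))⟩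
  have hfin : ∀ c : Set X, c.Finite → c ⊆ {x : X | ‖g x‖ = ‖g‖} →
      IsBoundary A (Set.univ \ ⋃ x ∈ c, V x) := by
    intro c hc
    induction c, hc using Set.Finite.induction_on with
    | empty => intro _; simpa using huniv
    | @insert a s _ _ ih =>
      intro hsub
      have h1 := hV a (hsub (Set.mem_insert a s)) _
        (ih ((Set.subset_insert a s).trans hsub))
      rwa [Set.sdiff_sdiff, Set.union_comm, ← Set.biUnion_insert] at h1
  obtain ⟨x, hx, hxg⟩ := ((isBoundary_iff A _).mp (hfin b hbf hbK)).2 g hg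
  exact hx.2 (hcov hxg)

end Silov

/-- A compact space `H` is removable iff for every compact Hausdorff `X`, every proper open
`U ⊂ X` whose closure is homeomorphic to a subspace of `H`, and every closed point-separating
unital subalgebra `A` of `C(X, ℂ)` with only trivial idempotents, the Šilov boundary of `A` is
contained in `X \ U`. -/
def IsRemovable.{u, v} (H : Type u) [TopologicalSpace H] : Prop :=
  ∀ (X : Type v) [TopologicalSpace X] [CompactSpace X] [T2Space X]
    (U : Set X) (A : Subalgebra ℂ C(X, ℂ)),
    IsOpen U → U ≠ Set.univ →
    (∃ K : Set H, Nonempty (closure U ≃ₜ K)) →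
    A.SeparatesPoints → IsClosed (A : Set C(X, ℂ)) →
    (∀ e ∈ A, IsIdempotentElem e → e = 0 ∨ e = 1) →
    silovBoundary A ⊆ Uᶜ

end FunctionAlgebra

universe u v

namespace FunctionAlgebra

open Filter Topology Bornology

/-! ### Cauchy transforms of functionals and Liouville's theorem -/

section Cut

variable {X : Type*} [TopologicalSpace X]

/-! Suppose the Šilov boundary S meets U and put K = closure U. Tietze extension turns the nice
family of H into a map φ from X to a metrizable space (`IsNice.exists_fibre_map`): its fibres in K
are scattered, and each continuous function is constant on all but countably many of them. From this
a Cantor set is built inside U.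

The engine is a cutting principle, `exists_indicator_mem_closure`. Let e and h lie in A, with e near
0 or 1 wherever h is not tiny, and e near 0 on a strip s₁ < Re h < s₂. Then the indicator of {Re h ≥
s₂, e ≈ 1} lies in the closure of A. For a functional annihilating A, the rounded e has
geometrically small moments against powers of h; the Cauchy transforms of its parts left and right
of the strip then glue to an entire function vanishing at infinity, so the right part is annihilated
too (`functional_eq_zero_of_strip`). If A is closed with only trivial idempotents, such an indicator
must be constant.

Consequently, for open V chosen suitably near a point of S, near-indicator functions in A of norm at
most k split only countably many fibres (`countable_splitValues`). If they split uncountably many,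
two of them would agree on a separating strip but differ further in, and the squared difference
could be cut to a nontrivial idempotent.

Finally, S has no relatively isolated point in U (`inter_silovBoundary_ne_singleton`), while fibres
are scattered, so φ is not constant on S ∩ W for open W ⊆ U meeting S. This gives a binary tree of
open sets with disjoint φ-images and shrinking φ-diameters. A branch whose intersection has two
points lies in one fibre, which A splits (`exists_mem_splitValues`); hence only countably many
branches are bad, and a Cantor set of good branches embeds in U. -/

theorem mem_resolventSet_of_forall_ne {h : C(X, ℂ)} {z : ℂ} (hz : ∀ x, h x ≠ z) :
    z ∈ resolventSet ℂ h := by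
  change IsUnit (algebraMap ℂ C(X, ℂ) z - h)
  rw [ContinuousMap.isUnit_iff_forall_ne_zero]
  intro x
  simpa [sub_eq_zero] using (hz x).symm

theorem resolvent_apply {h : C(X, ℂ)} {z : ℂ} (hz : ∀ x, h x ≠ z) (x : X) :
    resolvent h z x = (z - h x)⁻¹ := by
  have h1 := congrArg (fun f : C(X, ℂ) => f x)
    (Ring.mul_inverse_cancel _ (mem_resolventSet_of_forall_ne hz))
  simp only [ContinuousMap.mul_apply, ContinuousMap.sub_apply, ContinuousMap.one_apply] at h1
  exact eq_inv_of_mul_eq_one_right (by simpa [resolvent] using h1)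

variable [CompactSpace X]

theorem ne_of_norm_lt {h : C(X, ℂ)} {z : ℂ} (hz : ‖h‖ < ‖z‖) (x : X) : h x ≠ z := fun hx =>
  absurd (hx ▸ h.norm_coe_le_norm x) (not_le.mpr hz)

theorem hasSum_resolvent {h : C(X, ℂ)} {z : ℂ} (hz : ‖h‖ < ‖z‖) :
    HasSum (fun n : ℕ => (z⁻¹ ^ (n + 1)) • h ^ n) (resolvent h z) := by
  have hz0 : z ≠ 0 := norm_pos_iff.mp ((norm_nonneg _).trans_lt hz)
  have hx : ‖z⁻¹ • h‖ < 1 := by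
    rw [norm_smul, norm_inv, inv_mul_lt_iff₀ (norm_pos_iff.mpr hz0)]
    simpa using hz
  have h2 := (summable_geometric_of_norm_lt_one hx).hasSum.const_smul (z⁻¹)
  have h3 : z⁻¹ • ∑' i : ℕ, (z⁻¹ • h) ^ i = resolvent h z := by
    ext x
    have h4 := congrArg (fun f : C(X, ℂ) => f x) (geom_series_mul_neg _ hx)
    simp only [ContinuousMap.mul_apply, ContinuousMap.sub_apply, ContinuousMap.one_apply,
      ContinuousMap.smul_apply, smul_eq_mul] at h4
    rw [resolvent_apply (ne_of_norm_lt hz) x, ContinuousMap.smul_apply, smul_eq_mul]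
    refine eq_inv_of_mul_eq_one_left ?_
    rw [← h4]
    field_simp
  rw [h3] at h2
  refine (funext fun n => ?_ : (fun n : ℕ => (z⁻¹ ^ (n + 1)) • h ^ n) = _) ▸ h2
  rw [smul_pow, smul_smul, pow_succ']

/-- The Laurent series `∑ Mₙ z⁻ⁿ⁻¹` is holomorphic for `‖z‖ > 1/2` if `Mₙ = O(4⁻ⁿ)`. -/
theorem differentiableOn_laurent {M : ℕ → ℂ} {K : ℝ} (hM : ∀ n, ‖M n‖ ≤ K * (1 / 4) ^ n) :
    DifferentiableOn ℂ (fun z : ℂ => ∑' n, z⁻¹ ^ (n + 1) * M n) {z | 1 / 2 < ‖z‖} := by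
  have hU : IsOpen {z : ℂ | 1 / 2 < ‖z‖} := isOpen_lt continuous_const continuous_norm
  refine Complex.differentiableOn_tsum_of_summable_norm (u := fun n => 2 * K * (1 / 2) ^ n)
    (summable_geometric_two.mul_left _) (fun n => ?_) hU fun n z hz => ?_
  · refine DifferentiableOn.mul_const (DifferentiableOn.pow (differentiableOn_inv.mono ?_) _) _
    intro z hz
    exact norm_pos_iff.mp (lt_trans (by norm_num) hz)
  · have h1 : ‖z‖⁻¹ ≤ 2 := by
      rw [inv_le_comm₀ (lt_trans (by norm_num) hz) (by norm_num)]
      simpa using (show (1 : ℝ) / 2 < ‖z‖ from hz).le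
    rw [norm_mul, norm_pow, norm_inv]
    calc ‖z‖⁻¹ ^ (n + 1) * ‖M n‖ ≤ 2 ^ (n + 1) * (K * (1 / 4) ^ n) :=
          mul_le_mul (pow_le_pow_left₀ (by positivity) h1 _) (hM n) (norm_nonneg _) (by positivity)
      _ = 2 * K * (1 / 2) ^ n := by
          rw [show (1 / 4 : ℝ) = 1 / 2 * (1 / 2) by norm_num, mul_pow, pow_succ]
          have : (2 : ℝ) ^ n * (1 / 2) ^ n = 1 := by rw [← mul_pow]; norm_num
          linear_combination (2 * K * (1 / 2) ^ n) * this

/-- A functional whose moments `L ((θ₁ + θ₂) hⁿ)` are `O(4⁻ⁿ)` vanishes at `θ₁`, provided that a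
vertical strip to the right of `Re z = 1/2` separates the values of `h` on the two supports. -/
theorem functional_eq_zero_of_strip (L : C(X, ℂ) →L[ℂ] ℂ) (h θ₁ θ₂ : C(X, ℂ)) {s₁ s₂ K : ℝ}
    (hs₁ : 1 / 2 ≤ s₁) (hs : s₁ < s₂)
    (hmom : ∀ n : ℕ, ‖L ((θ₁ + θ₂) * h ^ n)‖ ≤ K * (1 / 4) ^ n)
    (h₁ : ∀ x, θ₁ x ≠ 0 → s₂ ≤ (h x).re) (h₂ : ∀ x, θ₂ x ≠ 0 → (h x).re ≤ s₁) : L θ₁ = 0 := by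
  -- Clamping Re h to [s₂, ∞) does not change h where θ₁ ≠ 0, but makes the resolvent exist on all
  -- of Re z < s₂. The function u₂ does the same on the other side.
  obtain ⟨u₁, hu₁, hu₁'⟩ : ∃ u : C(X, ℂ), (∀ x, s₂ ≤ (u x).re) ∧
      ∀ x, s₂ ≤ (h x).re → u x = h x := by
    refine ⟨⟨fun x => (max (h x).re s₂ : ℝ) + (h x).im * Complex.I, by fun_prop⟩, ?_, ?_⟩
    · intro x; simp
    · intro x hx; simp [max_eq_left hx, Complex.re_add_im]
  obtain ⟨u₂, hu₂, hu₂'⟩ : ∃ u : C(X, ℂ), (∀ x, (u x).re ≤ s₁) ∧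
      ∀ x, (h x).re ≤ s₁ → u x = h x := by
    refine ⟨⟨fun x => (min (h x).re s₁ : ℝ) + (h x).im * Complex.I, by fun_prop⟩, ?_, ?_⟩
    · intro x; simp
    · intro x hx; simp [min_eq_left hx, Complex.re_add_im]
  set A₁ : ℂ → ℂ := fun z => L (θ₁ * resolvent u₁ z) with hA₁
  set A₂ : ℂ → ℂ := fun z => L (θ₂ * resolvent u₂ z) with hA₂
  set M : ℕ → ℂ := fun n => L ((θ₁ + θ₂) * h ^ n) with hM
  set Ψ : ℂ → ℂ := fun z => ∑' n, z⁻¹ ^ (n + 1) * M n with hΨ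
  have hdiff : ∀ (θ u : C(X, ℂ)) (z : ℂ), (∀ x, u x ≠ z) →
      DifferentiableAt ℂ (fun z => L (θ * resolvent u z)) z := by
    intro θ u z hz
    have hd := (spectrum.hasDerivAt_resolvent_const_left
      (mem_resolventSet_of_forall_ne hz)).differentiableAt
    exact L.differentiableAt.comp z ((differentiableAt_const θ).mul hd)
  have hd₁ : ∀ z : ℂ, z.re < s₂ → DifferentiableAt ℂ A₁ z := fun z hz =>
    hdiff _ _ _ fun x hx => by have := hu₁ x; rw [hx] at this; linarith
  have hd₂ : ∀ z : ℂ, s₁ < z.re → DifferentiableAt ℂ A₂ z := fun z hz =>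
    hdiff _ _ _ fun x hx => by have := hu₂ x; rw [hx] at this; linarith
  have hΨo : IsOpen {z : ℂ | 1 / 2 < ‖z‖} := isOpen_lt continuous_const continuous_norm
  have hdΨ : ∀ z : ℂ, s₁ < z.re → DifferentiableAt ℂ Ψ z := fun z hz =>
    (differentiableOn_laurent hmom).differentiableAt
      (hΨo.mem_nhds (by have := Complex.re_le_norm z; exact lt_of_lt_of_le (by linarith) this))
  set R : ℝ := ‖h‖ + ‖u₁‖ + ‖u₂‖ with hR
  have hsum : ∀ z : ℂ, R < ‖z‖ → A₁ z = Ψ z - A₂ z := by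
    intro z hz
    have n0 := norm_nonneg h
    have n1 := norm_nonneg u₁
    have n2 := norm_nonneg u₂
    have hh : ‖h‖ < ‖z‖ := by linarith
    have hh1 : ‖u₁‖ < ‖z‖ := by linarith
    have hh2 : ‖u₂‖ < ‖z‖ := by linarith
    rw [eq_sub_iff_add_eq]
    have e1 : θ₁ * resolvent u₁ z + θ₂ * resolvent u₂ z = (θ₁ + θ₂) * resolvent h z := by
      ext x
      simp only [ContinuousMap.add_apply, ContinuousMap.mul_apply,
        resolvent_apply (ne_of_norm_lt hh) x, resolvent_apply (ne_of_norm_lt hh1) x,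
        resolvent_apply (ne_of_norm_lt hh2) x]
      by_cases c1 : θ₁ x = 0 <;> by_cases c2 : θ₂ x = 0
      · simp [c1, c2]
      · simp [c1, hu₂' x (h₂ x c2)]
      · simp [c2, hu₁' x (h₁ x c1)]
      · rw [hu₂' x (h₂ x c2), hu₁' x (h₁ x c1), add_mul]
    have e2 : HasSum (fun n : ℕ => z⁻¹ ^ (n + 1) * M n) (L ((θ₁ + θ₂) * resolvent h z)) := by
      have := L.hasSum ((hasSum_resolvent hh).mul_left (θ₁ + θ₂))
      convert this using 2 with n
      simp [hM]
    simp only [hA₁, hA₂, hΨ, ← map_add, e1]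
    exact e2.tsum_eq.symm
  -- The strip is connected and unbounded, so it contains points beyond R, and the identity theorem
  -- carries the equality down from there.
  have hstrip : ∀ z : ℂ, s₁ < z.re → z.re < s₂ → A₁ z = Ψ z - A₂ z := by
    set S : Set ℂ := {z | s₁ < z.re} ∩ {z | z.re < s₂} with hS
    have hSo : IsOpen S := (isOpen_lt continuous_const Complex.continuous_re).inter
      (isOpen_lt Complex.continuous_re continuous_const)
    have hSc : IsPreconnected S :=
      ((convex_halfSpace_re_gt s₁).inter (convex_halfSpace_re_lt s₂)).isPreconnected
    have han₁ : AnalyticOnNhd ℂ A₁ S :=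
      DifferentiableOn.analyticOnNhd (fun z hz => (hd₁ z hz.2).differentiableWithinAt) hSo
    have han₂ : AnalyticOnNhd ℂ (fun z => Ψ z - A₂ z) S :=
      DifferentiableOn.analyticOnNhd
        (fun z hz => ((hdΨ z hz.1).sub (hd₂ z hz.1)).differentiableWithinAt) hSo
    set z₀ : ℂ := ⟨(s₁ + s₂) / 2, R + 1⟩ with hz₀
    have hz₀S : z₀ ∈ S := by constructor <;> simp [hz₀] <;> linarith
    have hz₀R : R < ‖z₀‖ := by
      have : z₀.im ≤ ‖z₀‖ := Complex.im_le_norm z₀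
      have h' : z₀.im = R + 1 := rfl
      linarith
    have hev : A₁ =ᶠ[𝓝 z₀] fun z => Ψ z - A₂ z := by
      filter_upwards [(isOpen_lt continuous_const continuous_norm).mem_nhds hz₀R] with z hz
      exact hsum z hz
    exact fun z hz1 hz2 => han₁.eqOn_of_preconnected_of_eventuallyEq han₂ hSc hz₀S hev ⟨hz1, hz2⟩
  -- The two formulas agree on the overlap. Hence J is entire, and Liouville gives J = 0 because A₁
  -- vanishes at infinity.
  set J : ℂ → ℂ := fun z => if z.re < s₂ then A₁ z else Ψ z - A₂ z with hJ
  have hJd : Differentiable ℂ J := by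
    intro z
    by_cases hz : z.re < s₂
    · refine (hd₁ z hz).congr_of_eventuallyEq ?_
      filter_upwards [(isOpen_lt Complex.continuous_re continuous_const).mem_nhds hz] with w hw
      simp only [hJ]; rw [if_pos hw]
    · have hz' : s₁ < z.re := by linarith
      refine ((hdΨ z hz').sub (hd₂ z hz')).congr_of_eventuallyEq ?_
      filter_upwards [(isOpen_lt continuous_const Complex.continuous_re).mem_nhds hz'] with w hw
      by_cases hw2 : w.re < s₂
      · simp only [hJ]; rw [if_pos hw2]; exact hstrip w hw hw2
      · simp only [hJ]; rw [if_neg hw2]; rfl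
  have hbig : ∀ᶠ z : ℂ in cobounded ℂ, R < ‖z‖ :=
    tendsto_norm_cobounded_atTop.eventually_gt_atTop R
  have hJA : ∀ z : ℂ, R < ‖z‖ → J z = A₁ z := by
    intro z hz
    simp only [hJ]
    split_ifs
    · rfl
    · exact (hsum z hz).symm
  have htend : ∀ θ : C(X, ℂ), Tendsto (fun z => L (θ * resolvent u₁ z)) (cobounded ℂ) (𝓝 0) := by
    intro θ
    have h1 := (spectrum.resolvent_tendsto_cobounded (𝕜 := ℂ) u₁).const_mul θ
    have h2 := (L.continuous.tendsto _).comp h1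
    rw [mul_zero, map_zero] at h2
    exact h2
  have hJ0 : ∀ z, J z = 0 := fun z => by
    refine hJd.apply_eq_of_tendsto_cocompact z ?_
    rw [← Metric.cobounded_eq_cocompact]
    refine (htend θ₁).congr' ?_
    filter_upwards [hbig] with z hz using (hJA z hz).symm
  -- The 1/z coefficient of A₁ at infinity is L θ₁; here it is read off from θ₁ = (z - u₁) θ₁ (z -
  -- u₁)⁻¹.
  have hfin : ∀ᶠ z : ℂ in cobounded ℂ, L (-(θ₁ * u₁) * resolvent u₁ z) = L θ₁ := by
    filter_upwards [hbig] with z hz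
    have hh1 : ‖u₁‖ < ‖z‖ := by
      have := norm_nonneg h
      have := norm_nonneg u₂
      linarith
    have e : θ₁ = z • (θ₁ * resolvent u₁ z) + -(θ₁ * u₁) * resolvent u₁ z := by
      ext x
      have hne : z - u₁ x ≠ 0 := sub_ne_zero.mpr (ne_of_norm_lt hh1 x).symm
      simp only [ContinuousMap.add_apply, ContinuousMap.mul_apply, ContinuousMap.smul_apply,
        ContinuousMap.neg_apply, smul_eq_mul, resolvent_apply (ne_of_norm_lt hh1) x]
      field_simp
      ring
    have hz0 : L (θ₁ * resolvent u₁ z) = 0 := (hJA z hz).symm.trans (hJ0 z)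
    conv_rhs => rw [e]
    rw [map_add, map_smul, hz0, smul_zero, zero_add]
  have := (htend (-(θ₁ * u₁))).congr' hfin
  exact (tendsto_nhds_unique this tendsto_const_nhds).symm ▸ rfl

end Cut

/-! ### Polynomials that round values near 0 and 1 -/

/-- The upper half of the binomial expansion of `(t + (1 - t)) ^ (2 * n)`: a polynomial in `t` of
degree `2 * n` which is close to `0` near `0` and close to `1` near `1`. -/
def halfBinomial {R : Type*} [CommRing R] (n : ℕ) (t : R) : R :=
  ∑ i ∈ Finset.Ico n (2 * n + 1), t ^ i * (1 - t) ^ (2 * n - i) * ((2 * n).choose i : R)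

theorem one_sub_halfBinomial {R : Type*} [CommRing R] (n : ℕ) (t : R) :
    1 - halfBinomial n t =
      ∑ i ∈ Finset.range n, t ^ i * (1 - t) ^ (2 * n - i) * ((2 * n).choose i : R) := by
  have h := add_pow t (1 - t) (2 * n)
  rw [add_sub_cancel, one_pow, ← Finset.sum_range_add_sum_Ico _ (by omega : n ≤ 2 * n + 1)] at h
  rw [halfBinomial, sub_eq_iff_eq_add]
  exact h

theorem halfBinomial_mem {X : Type*} [TopologicalSpace X] (A : Subalgebra ℂ C(X, ℂ))
    {e : C(X, ℂ)} (he : e ∈ A) (n : ℕ) : halfBinomial n e ∈ A :=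
  A.sum_mem fun _ _ => A.mul_mem
    (A.mul_mem (A.pow_mem he _) (A.pow_mem (A.sub_mem A.one_mem he) _)) (A.natCast_mem _)

theorem halfBinomial_apply {X : Type*} [TopologicalSpace X] (e : C(X, ℂ)) (n : ℕ) (x : X) :
    halfBinomial n e x = halfBinomial n (e x) := by
  simp [halfBinomial, ContinuousMap.sum_apply]

theorem norm_sum_binomial_le {n : ℕ} {t : ℂ} {a : ℝ} {s : Finset ℕ}
    (hs : s ⊆ Finset.range (2 * n + 1)) (ha : 0 ≤ a)
    (h : ∀ i ∈ s, ‖t‖ ^ i * ‖1 - t‖ ^ (2 * n - i) ≤ a) :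
    ‖∑ i ∈ s, t ^ i * (1 - t) ^ (2 * n - i) * ((2 * n).choose i : ℂ)‖ ≤ a * 4 ^ n := by
  calc ‖∑ i ∈ s, t ^ i * (1 - t) ^ (2 * n - i) * ((2 * n).choose i : ℂ)‖
      ≤ ∑ i ∈ s, a * ((2 * n).choose i : ℝ) := by
        refine norm_sum_le_of_le _ fun i hi => ?_
        rw [norm_mul, norm_mul, norm_pow, norm_pow, Complex.norm_natCast]
        exact mul_le_mul_of_nonneg_right (h i hi) (Nat.cast_nonneg _)
    _ ≤ ∑ i ∈ Finset.range (2 * n + 1), a * ((2 * n).choose i : ℝ) :=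
        Finset.sum_le_sum_of_subset_of_nonneg hs fun i _ _ => by positivity
    _ = a * 4 ^ n := by
        rw [← Finset.mul_sum, ← Nat.cast_sum, Nat.sum_range_choose, pow_mul]
        norm_num

/-- At least n of the 2n factors are at most 1/20 and the rest at most 21/20. The resulting 21/400
still beats the binomial total 4ⁿ, since 4 · 21/400 < 1/4. -/
theorem pow_mul_pow_le {u v : ℝ} (hu0 : 0 ≤ u) (hv0 : 0 ≤ v) (hu : u ≤ 1 / 20) (hv : v ≤ 21 / 20)
    {n i j : ℕ} (hi : n ≤ i) (hij : i + j = 2 * n) : u ^ i * v ^ j ≤ (21 / 400) ^ n := by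
  obtain ⟨k, rfl⟩ := Nat.exists_eq_add_of_le hi
  have hk : k + j = n := by omega
  calc u ^ (n + k) * v ^ j ≤ ((1 / 20) ^ n * (21 / 20) ^ k) * (21 / 20) ^ j := by
        rw [pow_add]
        have h1 := pow_le_pow_left₀ hu0 hu n
        have h2 := pow_le_pow_left₀ hu0 (hu.trans (by norm_num : (1 : ℝ) / 20 ≤ 21 / 20)) k
        have h3 := pow_le_pow_left₀ hv0 hv j
        gcongr
    _ = (21 / 400) ^ n := by
        rw [mul_assoc, ← pow_add, hk, ← mul_pow]
        norm_num

theorem norm_halfBinomial_le_of_near_zero (n : ℕ) {t : ℂ} (ht : ‖t‖ ≤ 1 / 20) :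
    ‖halfBinomial n t‖ ≤ (1 / 4) ^ n := by
  have h1 : ‖1 - t‖ ≤ 21 / 20 := (norm_sub_le _ _).trans (by rw [norm_one]; linarith)
  refine (norm_sum_binomial_le (a := (21 / 400) ^ n) ?_ (by positivity) ?_).trans ?_
  · intro i hi
    simp only [Finset.mem_Ico, Finset.mem_range] at hi ⊢
    exact hi.2
  · intro i hi
    simp only [Finset.mem_Ico] at hi
    exact pow_mul_pow_le (norm_nonneg _) (norm_nonneg _) ht h1 hi.1 (by omega)
  · rw [← mul_pow]
    exact pow_le_pow_left₀ (by norm_num) (by norm_num) n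

theorem norm_one_sub_halfBinomial_le_of_near_one (n : ℕ) {t : ℂ} (ht : ‖t - 1‖ ≤ 1 / 20) :
    ‖1 - halfBinomial n t‖ ≤ (1 / 4) ^ n := by
  rw [norm_sub_rev] at ht
  have h1 : ‖t‖ ≤ 21 / 20 := by
    have := norm_sub_le 1 (1 - t)
    rw [sub_sub_cancel, norm_one] at this
    linarith
  rw [one_sub_halfBinomial]
  refine (norm_sum_binomial_le (a := (21 / 400) ^ n) ?_ (by positivity) ?_).trans ?_
  · intro i hi
    simp only [Finset.mem_range] at hi ⊢
    omega
  · intro i hi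
    simp only [Finset.mem_range] at hi
    rw [mul_comm]
    exact pow_mul_pow_le (norm_nonneg _) (norm_nonneg _) ht h1 (by omega) (by omega)
  · rw [← mul_pow]
    exact pow_le_pow_left₀ (by norm_num) (by norm_num) n

/-- A crude growth bound for points where e is uncontrolled; there the tiny factor hⁿ absorbs it. -/
theorem norm_halfBinomial_le (n : ℕ) {t : ℂ} {C : ℝ} (ht : ‖t‖ ≤ C) :
    ‖halfBinomial n t‖ ≤ ((2 * C + 1) ^ 2) ^ n := by
  calc ‖halfBinomial n t‖
      ≤ ∑ i ∈ Finset.Ico n (2 * n + 1), ‖t‖ ^ i * ‖1 - t‖ ^ (2 * n - i) * ((2 * n).choose i : ℝ) := by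
        refine norm_sum_le_of_le _ fun i _ => ?_
        rw [norm_mul, norm_mul, norm_pow, norm_pow, Complex.norm_natCast]
    _ ≤ ∑ i ∈ Finset.range (2 * n + 1),
          ‖t‖ ^ i * ‖1 - t‖ ^ (2 * n - i) * ((2 * n).choose i : ℝ) := by
        refine Finset.sum_le_sum_of_subset_of_nonneg ?_ fun i _ _ => by positivity
        intro i hi
        simp only [Finset.mem_Ico, Finset.mem_range] at hi ⊢
        exact hi.2
    _ = (‖t‖ + ‖1 - t‖) ^ (2 * n) := (add_pow _ _ _).symm
    _ ≤ (2 * C + 1) ^ (2 * n) := by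
        refine pow_le_pow_left₀ (by positivity) ?_ _
        have := norm_sub_le 1 t
        rw [norm_one] at this
        linarith
    _ = ((2 * C + 1) ^ 2) ^ n := pow_mul _ _ _

/-! ### Cutting out an indicator function along a strip -/

section Cut

variable {X : Type*} [TopologicalSpace X] [CompactSpace X] [T2Space X]

/-- If `e` is close to `0` or `1` wherever `h` is not very small, and close to `0` on the strip
`s₁ < Re h < s₂`, then the indicator function of `{s₂ ≤ Re h, e ≈ 1}` belongs to the closure
of the algebra. -/
theorem exists_indicator_mem_closure (A : Subalgebra ℂ C(X, ℂ)) {e h : C(X, ℂ)} (he : e ∈ A)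
    (hh : h ∈ A) {C c s₁ s₂ : ℝ} (hc : 0 ≤ c) (hC : (2 * C + 1) ^ 2 * c ≤ 1 / 4)
    (hs₁ : 1 / 2 ≤ s₁) (hs : s₁ < s₂) (hle : ∀ x, ‖h x‖ ≤ 1)
    (hcases : ∀ x, ‖e x‖ ≤ 1 / 20 ∨ ‖e x - 1‖ ≤ 1 / 20 ∨ (‖e x‖ ≤ C ∧ ‖h x‖ ≤ c))
    (hstrip : ∀ x, s₁ < (h x).re → (h x).re < s₂ → ‖e x‖ ≤ 1 / 20) :
    ∃ θ ∈ closure (A : Set C(X, ℂ)), ∀ x,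
      (s₂ ≤ (h x).re → ‖e x - 1‖ ≤ 1 / 20 → θ x = 1) ∧
      (¬ (s₂ ≤ (h x).re ∧ ‖e x - 1‖ ≤ 1 / 20) → θ x = 0) := by
  have hnot : ∀ z : ℂ, ‖z‖ ≤ 1 / 20 → ‖z - 1‖ ≤ 1 / 20 → False := fun z h0 h1 => by
    have := norm_sub_le z (z - 1)
    rw [sub_sub_cancel, norm_one] at this
    linarith
  have hcases' : ∀ x, 1 / 4 < ‖h x‖ → ‖e x‖ ≤ 1 / 20 ∨ ‖e x - 1‖ ≤ 1 / 20 := by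
    intro x hx
    rcases hcases x with h1 | h1 | ⟨h1, h2⟩
    · exact Or.inl h1
    · exact Or.inr h1
    · have hC0 : 0 ≤ C := (norm_nonneg _).trans h1
      nlinarith [mul_nonneg hC0 hc, mul_nonneg (mul_nonneg hC0 hC0) hc]
  -- A Urysohn function rounding e where ‖h‖ ≥ 1/4. Its values elsewhere are immaterial, because
  -- ‖h‖ⁿ ≤ 4⁻ⁿ there.
  obtain ⟨f, hf0, hf1, hf01⟩ := exists_continuous_zero_one_of_isClosed
    (s := {x | ‖e x‖ ≤ 1 / 20} ∩ {x | 1 / 4 ≤ ‖h x‖})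
    (t := {x | ‖e x - 1‖ ≤ 1 / 20} ∩ {x | 1 / 4 ≤ ‖h x‖})
    ((isClosed_le (by fun_prop) continuous_const).inter
      (isClosed_le continuous_const (by fun_prop)))
    ((isClosed_le (by fun_prop) continuous_const).inter
      (isClosed_le continuous_const (by fun_prop)))
    (Set.disjoint_left.mpr fun x h0 h1 => hnot _ h0.1 h1.1)
  set ρ : ℝ → ℝ := fun s => max 0 (min 1 ((s - s₁) / (s₂ - s₁))) with hρ
  have hρc : Continuous ρ := by fun_prop
  have hd : 0 < s₂ - s₁ := sub_pos.mpr hs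
  have hρ0 : ∀ s, s ≤ s₁ → ρ s = 0 := fun s h => by
    have : (s - s₁) / (s₂ - s₁) ≤ 0 := div_nonpos_of_nonpos_of_nonneg (by linarith) hd.le
    exact max_eq_left ((min_le_right _ _).trans this)
  have hρ1 : ∀ s, s₂ ≤ s → ρ s = 1 := fun s h => by
    have : 1 ≤ (s - s₁) / (s₂ - s₁) := (one_le_div hd).mpr (by linarith)
    simp only [hρ, min_eq_left this]; norm_num
  -- Since f vanishes over the strip, where ρ climbs from 0 to 1, this cuts f cleanly into a right
  -- part θ₁ and a left part θ₂.
  let θ₁ : C(X, ℂ) := ⟨fun x => (f x : ℂ) * (ρ (h x).re : ℂ), by fun_prop⟩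
  let θ₂ : C(X, ℂ) := ⟨fun x => (f x : ℂ) * (1 - (ρ (h x).re : ℂ)), by fun_prop⟩
  have hθ₁ : ∀ x, θ₁ x = (f x : ℂ) * (ρ (h x).re : ℂ) := fun _ => rfl
  have hθ₂ : ∀ x, θ₂ x = (f x : ℂ) * (1 - (ρ (h x).re : ℂ)) := fun _ => rfl
  have hre : ∀ x, (h x).re ≤ ‖h x‖ := fun x => Complex.re_le_norm _
  have hfs : ∀ x, s₁ < (h x).re → (h x).re < s₂ → f x = 0 := fun x h1 h2 =>
    hf0 ⟨hstrip x h1 h2, by have := hre x; simp only [Set.mem_ofPred_eq]; linarith⟩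
  have h₁ : ∀ x, θ₁ x ≠ 0 → s₂ ≤ (h x).re := by
    intro x hx
    by_contra hlt
    rw [not_le] at hlt
    rcases le_or_gt (h x).re s₁ with h1 | h1
    · exact hx (by simp [hθ₁, hρ0 _ h1])
    · exact hx (by simp [hθ₁, hfs x h1 hlt])
  have h₂ : ∀ x, θ₂ x ≠ 0 → (h x).re ≤ s₁ := by
    intro x hx
    by_contra hlt
    rw [not_le] at hlt
    rcases lt_or_ge (h x).re s₂ with h1 | h1
    · exact hx (by simp [hθ₂, hfs x hlt h1])
    · exact hx (by simp [hθ₂, hρ1 _ h1])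
  refine ⟨θ₁, ?_, fun x => ⟨fun h1 h2 => ?_, fun h1 => ?_⟩⟩
  · by_contra hcl
    obtain ⟨L, u, hLu, huL⟩ := RCLike.geometric_hahn_banach_closed_point (𝕜 := ℂ)
      (s := closure (A : Set C(X, ℂ))) (x := θ₁)
      (A.toSubmodule.restrictScalars ℝ).convex.closure isClosed_closure hcl
    -- A functional with real part bounded above on a complex subspace vanishes there.
    have hLA : ∀ a ∈ A, L a = 0 := by
      intro a ha
      by_contra hne
      have h1 := hLu ((((|u| + 1 : ℝ) : ℂ) * (L a)⁻¹) • a) (subset_closure (A.smul_mem ha _))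
      rw [map_smul, smul_eq_mul, mul_assoc, inv_mul_cancel₀ hne, mul_one] at h1
      simp only [RCLike.re_to_complex, Complex.ofReal_re] at h1
      linarith [le_abs_self u]
    -- Subtracting `halfBinomial n e * h ^ n`, an element of A, costs nothing under L and leaves a
    -- function that is uniformly O(4⁻ⁿ).
    have hmom : ∀ n : ℕ, ‖L ((θ₁ + θ₂) * h ^ n)‖ ≤ (‖L‖ * 3) * (1 / 4) ^ n := by
      intro n
      have h0 : L ((θ₁ + θ₂) * h ^ n) = L ((θ₁ + θ₂ - halfBinomial n e) * h ^ n) := by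
        rw [sub_mul, map_sub, hLA _ (A.mul_mem (halfBinomial_mem A he n) (A.pow_mem hh n)),
          sub_zero]
      rw [h0, mul_assoc]
      refine (L.le_opNorm _).trans (mul_le_mul_of_nonneg_left ?_ (norm_nonneg _))
      rw [ContinuousMap.norm_le _ (by positivity)]
      intro x
      have hsum : θ₁ x + θ₂ x = (f x : ℂ) := by rw [hθ₁, hθ₂]; ring
      rw [ContinuousMap.mul_apply, ContinuousMap.sub_apply, ContinuousMap.add_apply, hsum,
        halfBinomial_apply, ContinuousMap.pow_apply, norm_mul, norm_pow]
      have hfn : ‖(f x : ℂ)‖ ≤ 1 := by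
        rw [Complex.norm_real, Real.norm_of_nonneg (hf01 x).1]; exact (hf01 x).2
      have hq : (0 : ℝ) ≤ (1 / 4) ^ n := by positivity
      have hq1 : ((1 : ℝ) / 4) ^ n ≤ 1 := pow_le_one₀ (by norm_num) (by norm_num)
      have hn1 : ‖h x‖ ^ n ≤ 1 := pow_le_one₀ (norm_nonneg _) (hle x)
      have hn0 : 0 ≤ ‖h x‖ ^ n := by positivity
      rcases le_or_gt (1 / 4) ‖h x‖ with hbig | hsmall
      · have hb : ‖(f x : ℂ) - halfBinomial n (e x)‖ ≤ (1 / 4) ^ n := by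
          have hc : ‖e x‖ ≤ 1 / 20 ∨ ‖e x - 1‖ ≤ 1 / 20 := by
            rcases hbig.lt_or_eq with hb | hb
            · exact hcases' x hb
            rcases hcases x with h1 | h1 | ⟨h1, h2⟩
            · exact Or.inl h1
            · exact Or.inr h1
            · have hC0 : 0 ≤ C := (norm_nonneg _).trans h1
              have hc4 : 1 / 4 ≤ c := by linarith
              refine Or.inl (h1.trans ?_)
              nlinarith [mul_nonneg hC0 (sub_nonneg.mpr hc4),
                mul_nonneg (mul_nonneg hC0 hC0) (sub_nonneg.mpr hc4)]
          rcases hc with h1 | h1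
          · rw [show f x = 0 from hf0 ⟨h1, hbig⟩, Complex.ofReal_zero, zero_sub, norm_neg]
            exact norm_halfBinomial_le_of_near_zero n h1
          · rw [show f x = 1 from hf1 ⟨h1, hbig⟩, Complex.ofReal_one]
            exact norm_one_sub_halfBinomial_le_of_near_one n h1
        calc ‖(f x : ℂ) - halfBinomial n (e x)‖ * ‖h x‖ ^ n ≤ (1 / 4) ^ n * 1 :=
              mul_le_mul hb hn1 hn0 hq
          _ ≤ 3 * (1 / 4) ^ n := by linarith
      · have hn4 : ‖h x‖ ^ n ≤ (1 / 4) ^ n := pow_le_pow_left₀ (norm_nonneg _) hsmall.le n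
        have htri := norm_sub_le (f x : ℂ) (halfBinomial n (e x))
        have hnear : ‖halfBinomial n (e x)‖ ≤ 2 →
            ‖(f x : ℂ) - halfBinomial n (e x)‖ * ‖h x‖ ^ n ≤ 3 * (1 / 4) ^ n := fun h2 =>
          mul_le_mul (by linarith) hn4 hn0 (by norm_num)
        rcases hcases x with h1 | h1 | ⟨h1, h2⟩
        · exact hnear ((norm_halfBinomial_le_of_near_zero n h1).trans (by linarith))
        · refine hnear ?_
          have h2 := norm_one_sub_halfBinomial_le_of_near_one n h1
          have h3 := norm_sub_le 1 (1 - halfBinomial n (e x))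
          rw [sub_sub_cancel, norm_one] at h3
          linarith
        · have h3 := norm_halfBinomial_le n h1
          calc ‖(f x : ℂ) - halfBinomial n (e x)‖ * ‖h x‖ ^ n
              ≤ (1 + ((2 * C + 1) ^ 2) ^ n) * ‖h x‖ ^ n :=
                mul_le_mul_of_nonneg_right (by linarith) hn0
            _ = ‖h x‖ ^ n + ((2 * C + 1) ^ 2) ^ n * ‖h x‖ ^ n := by ring
            _ ≤ (1 / 4) ^ n + ((2 * C + 1) ^ 2) ^ n * c ^ n := by
                have := pow_le_pow_left₀ (norm_nonneg _) h2 n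
                gcongr
            _ ≤ (1 / 4) ^ n + (1 / 4) ^ n := by
                rw [← mul_pow]
                have := pow_le_pow_left₀ (by positivity) hC n
                gcongr
            _ ≤ 3 * (1 / 4) ^ n := by linarith
    have hL0 := functional_eq_zero_of_strip L h θ₁ θ₂ hs₁ hs hmom h₁ h₂
    have hu0 := hLu 0 (subset_closure A.zero_mem)
    rw [hL0] at huL
    rw [map_zero] at hu0
    exact lt_asymm hu0 huL
  · rw [hθ₁, hρ1 _ h1, show f x = 1 from
      hf1 ⟨h2, by have := hre x; simp only [Set.mem_ofPred_eq]; linarith⟩]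
    simp
  · by_contra hne
    have hs2 := h₁ x hne
    have hb : 1 / 4 < ‖h x‖ := by have := hre x; linarith
    rcases hcases' x hb with h2 | h2
    · exact hne (by rw [hθ₁, show f x = 0 from hf0 ⟨h2, hb.le⟩]; simp)
    · exact h1 ⟨hs2, h2⟩

end Cut

/-! ### Scattered sets, gaps and near-indicators on fibres -/

theorem exists_Icc_subset_of_interior_nonempty {S : Set ℝ} (h : (interior S).Nonempty) :
    ∃ a b, a < b ∧ Set.Icc a b ⊆ S := by
  obtain ⟨x, hx⟩ := h
  obtain ⟨ε, hε, hb⟩ := Metric.isOpen_iff.mp isOpen_interior x hx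
  refine ⟨x - ε / 2, x + ε / 2, by linarith, ?_⟩
  rw [← Real.closedBall_eq_Icc]
  exact (Metric.closedBall_subset_ball (by linarith)).trans (hb.trans interior_subset)

/-- A continuous real-valued image of a compact scattered set contains no interval. -/
theorem IsScattered.interior_image_eq_empty.{w} {X : Type w} [TopologicalSpace X] {S : Set X}
    (hsc : IsScattered S) (hS : IsCompact S) {f : X → ℝ} (hf : Continuous f) :
    interior (f '' S) = ∅ := by
  by_contra hne
  obtain ⟨a, b, hab, hsub⟩ := exists_Icc_subset_of_interior_nonempty
    (Set.nonempty_iff_ne_empty.mpr hne)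
  have hD : IsCompact (S ∩ f ⁻¹' Set.Icc a b) := hS.inter_right (isClosed_Icc.preimage hf)
  set D : Set X := S ∩ f ⁻¹' Set.Icc a b
  have : CompactSpace D := isCompact_iff_compactSpace.mp hD
  let F : D → Set.Icc a b := fun x => ⟨f x, x.2.2⟩
  have hF : Continuous F := (hf.comp continuous_subtype_val).subtype_mk _
  have hFs : F.Surjective := by
    rintro ⟨y, hy⟩
    obtain ⟨x, hx, rfl⟩ := hsub hy
    exact ⟨⟨x, hx, hy⟩, rfl⟩
  -- A minimal closed set E still mapping onto the interval; `ULift` only aligns universes. Removing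
  -- an isolated point of E will contradict minimality.
  obtain ⟨E, hEc, hEu, hE⟩ := exists_compact_surjective_zorn_subset
    (A := ULift.{w} (Set.Icc a b)) (X := ULift.up ∘ F) (continuous_uliftUp.comp hF)
    (ULift.up_surjective.comp hFs)
  have hne : E.Nonempty := by
    have : ((ULift.up ∘ F) '' E).Nonempty := by
      rw [hEu]; exact ⟨⟨⟨a, le_rfl, hab.le⟩⟩, trivial⟩
    exact this.of_image
  obtain ⟨x, ⟨e, heE, rfl⟩, U, hU, hUT⟩ := hsc (Subtype.val '' E)
    (by rintro _ ⟨y, -, rfl⟩; exact y.2.1) (hne.image _)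
  let E₀ : Set E := {z | ((z : D) : X) ∉ U}
  have heU : ((e : D) : X) ∈ U := (hUT.ge rfl).1
  have hE₀c : IsClosed E₀ :=
    (hU.preimage (continuous_subtype_val.comp continuous_subtype_val)).isClosed_compl
  refine hE E₀ (fun h => ?_) hE₀c ?_
  · have : (⟨e, heE⟩ : E) ∈ E₀ := h ▸ trivial
    exact this heU
  -- Without e at most the value F e is lost. The remaining image is closed and dense in the
  -- interval, hence everything.
  · have hcl : IsClosed (E.domRestrict F '' E₀) :=
      (hE₀c.isCompact.image (hF.comp continuous_subtype_val)).isClosed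
    have hsub : {F e}ᶜ ⊆ E.domRestrict F '' E₀ := by
      intro y hy
      obtain ⟨z, hz, hzy⟩ := hEu.ge (trivial : ULift.up y ∈ Set.univ)
      obtain rfl : F z = y := ULift.up_injective hzy
      refine ⟨⟨z, hz⟩, fun hzU => hy ?_, rfl⟩
      have h1 : (z : X) ∈ U ∩ Subtype.val '' E := ⟨hzU, z, hz, rfl⟩
      rw [hUT] at h1
      rw [Set.mem_singleton_iff, Subtype.ext h1]
    have : PreconnectedSpace (Set.Icc a b) := Subtype.preconnectedSpace isPreconnected_Icc
    have : Nontrivial (Set.Icc a b) :=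
      ⟨⟨⟨a, le_rfl, hab.le⟩, ⟨b, hab.le, le_rfl⟩, fun h => hab.ne (congrArg Subtype.val h)⟩⟩
    have hdense : Dense ({F e}ᶜ : Set (Set.Icc a b)) := dense_compl_singleton _
    have huniv : E.domRestrict F '' E₀ = Set.univ :=
      hcl.closure_eq ▸ (hdense.mono hsub).closure_eq
    refine Set.eq_univ_of_forall fun y => ?_
    obtain ⟨z, hz, hzy⟩ := huniv.ge (trivial : y.down ∈ Set.univ)
    exact ⟨z, hz, ULift.down_injective hzy⟩

theorem interior_biUnion_eq_empty {ι : Type*} {I : Set ι} (hI : I.Countable) {C : ι → Set ℝ}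
    (hC : ∀ i ∈ I, IsClosed (C i)) (hC' : ∀ i ∈ I, interior (C i) = ∅) :
    interior (⋃ i ∈ I, C i) = ∅ := by
  rw [interior_eq_empty_iff_dense_compl, Set.compl_iUnion₂]
  exact dense_biInter_of_isOpen (fun i hi => (hC i hi).isOpen_compl) hI
    fun i hi => interior_eq_empty_iff_dense_compl.mp (hC' i hi)

/-- A closed set of reals with empty interior leaves a gap with rational end points in every
interval. -/
theorem exists_rat_gap {S : Set ℝ} (hS : IsClosed S) (hS' : interior S = ∅) {a b : ℝ}
    (hab : a < b) : ∃ p q : ℚ, a < p ∧ (p : ℝ) < q ∧ (q : ℝ) < b ∧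
      ∀ s ∈ S, ¬ ((p : ℝ) ≤ s ∧ s ≤ q) := by
  obtain ⟨x, hx, hxS⟩ := (interior_eq_empty_iff_dense_compl.mp hS').inter_open_nonempty
    (Set.Ioo a b) isOpen_Ioo (Set.nonempty_Ioo.mpr hab)
  obtain ⟨ε, hε, hb⟩ := Metric.isOpen_iff.mp (isOpen_Ioo.inter hS.isOpen_compl) x ⟨hx, hxS⟩
  obtain ⟨p, hp1, hp2⟩ := exists_rat_btwn (show x - ε < x by linarith)
  obtain ⟨q, hq1, hq2⟩ := exists_rat_btwn (show x < x + ε by linarith)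
  rw [Real.ball_eq_Ioo] at hb
  refine ⟨p, q, (hb ⟨hp1, by linarith⟩).1.1, hp2.trans hq1, (hb ⟨by linarith, hq2⟩).1.2, ?_⟩
  rintro s hs ⟨h1, h2⟩
  exact (hb ⟨by linarith, by linarith⟩ : s ∈ _).2 hs

/-- In a second countable space, countably many sets suffice to separate disjoint compact sets. -/
theorem exists_countable_separating_compacts (Y : Type*) [TopologicalSpace Y]
    [SecondCountableTopology Y] [T2Space Y] :
    ∃ 𝓕 : Set (Set Y), 𝓕.Countable ∧ ∀ P Q : Set Y, IsCompact P → IsCompact Q → Disjoint P Q →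
      ∃ B ∈ 𝓕, Q ⊆ B ∧ Disjoint P B := by
  refine ⟨Set.sUnion '' {t | t.Finite ∧ t ⊆ TopologicalSpace.countableBasis Y},
    (Set.countable_ofPred_finite_subset (TopologicalSpace.countable_countableBasis Y)).image _,
    fun P Q hP hQ hPQ => ?_⟩
  obtain ⟨t, ht, htf, htQ⟩ := hQ.elim_finite_subcover_image
    (b := {b | b ∈ TopologicalSpace.countableBasis Y ∧ b ⊆ Pᶜ}) (c := id)
    (fun b hb => TopologicalSpace.isOpen_of_mem_countableBasis hb.1)
    (fun q hq => by
      obtain ⟨v, hv, hqv, hvP⟩ := (TopologicalSpace.isBasis_countableBasis Y).exists_subset_of_mem_open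
        (Set.disjoint_right.mp hPQ hq : q ∈ Pᶜ) hP.isClosed.isOpen_compl
      exact Set.mem_biUnion (⟨hv, hvP⟩ : v ∈ {b | _ ∧ _}) hqv)
  refine ⟨⋃₀ t, ⟨t, ⟨htf, fun b hb => (ht hb).1⟩, rfl⟩, ?_, ?_⟩
  · rw [Set.sUnion_eq_biUnion]; exact htQ
  · rw [Set.disjoint_sUnion_right]
    exact fun b hb => Set.disjoint_left.mpr fun x hx hxb => (ht hb).2 hxb hx

/-- On a compact scattered set, a point-separating algebra contains functions close to indicator
functions of relatively clopen sets separating two given points. -/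
theorem exists_near_indicator {X : Type*} [TopologicalSpace X] [T2Space X]
    (A : Subalgebra ℂ C(X, ℂ)) (hA : A.SeparatesPoints) {F : Set X} (hF : IsCompact F)
    (hsc : IsScattered F) {x y : X} (hx : x ∈ F) (hy : y ∈ F) (hxy : x ≠ y) :
    ∃ g ∈ A, (∀ z ∈ F, ‖g z‖ ≤ 1 / 200 ∨ ‖g z - 1‖ ≤ 1 / 200) ∧ ‖g x‖ ≤ 1 / 200 ∧
      ‖g y - 1‖ ≤ 1 / 200 := by
  obtain ⟨_, ⟨g₀, hg₀, rfl⟩, hne⟩ := hA hxy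
  have hne' : g₀ y - g₀ x ≠ 0 := sub_ne_zero.mpr (Ne.symm hne)
  set g₁ : C(X, ℂ) := (g₀ y - g₀ x)⁻¹ • (g₀ - algebraMap ℂ C(X, ℂ) (g₀ x)) with hg₁
  have hg₁A : g₁ ∈ A := A.smul_mem (A.sub_mem hg₀ (A.algebraMap_mem _)) _
  have hg₁x : g₁ x = 0 := by simp [hg₁]
  have hg₁y : g₁ y = 1 := by simp [hg₁, hne']
  have : CompactSpace F := isCompact_iff_compactSpace.mp hF
  let r : C(X, ℂ) →ₐ[ℂ] C(F, ℂ) :=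
    ContinuousMap.compRightAlgHom ℂ ℂ (⟨Subtype.val, continuous_subtype_val⟩ : C(F, X))
  have hr : ∀ (g : C(X, ℂ)) (z : F), r g z = g z := fun _ _ => rfl
  set N : ℝ := ‖r g₁‖ with hN
  have hN1 : 1 ≤ N := by
    have := (r g₁).norm_coe_le_norm ⟨y, hy⟩
    rwa [hr, hg₁y, norm_one] at this
  have hN0 : (0 : ℝ) < 4 * N := by linarith
  obtain ⟨p, q, hp0, hpq, hq1, hgap⟩ := exists_rat_gap
    (hF.image (Complex.continuous_re.comp g₁.continuous)).isClosed
    (hsc.interior_image_eq_empty hF (Complex.continuous_re.comp g₁.continuous))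
    (zero_lt_one' ℝ)
  -- The affine rescaling keeps ‖h‖ ≤ 1 and moves the gap, which lies between Re g₁ = 0 and Re g₁ =
  -- 1, to the right of 1/2.
  set h : C(F, ℂ) := algebraMap ℂ C(F, ℂ) (3 / 4) + ((1 / (4 * N) : ℝ) : ℂ) • r g₁ with hh
  have hhA : h ∈ A.map r := add_mem ((A.map r).algebraMap_mem _)
    ((A.map r).smul_mem (Subalgebra.mem_map.mpr ⟨g₁, hg₁A, rfl⟩) _)
  have hhz : ∀ z : F, h z = 3 / 4 + ((1 / (4 * N) : ℝ) : ℂ) * g₁ z := fun z => by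
    simp [hh, hr]
  have hre : ∀ z : F, (h z).re = 3 / 4 + (g₁ z).re / (4 * N) := fun z => by
    rw [hhz, Complex.add_re, Complex.re_ofReal_mul,
      show (3 / 4 : ℂ) = ((3 / 4 : ℝ) : ℂ) by push_cast; ring, Complex.ofReal_re]
    ring
  -- With e = 1 the strip condition holds vacuously because h takes no value in the strip; C = c = 0
  -- since the third alternative never occurs.
  obtain ⟨θ, hθ, hθ'⟩ := exists_indicator_mem_closure (A.map r) (e := 1) (h := h)
    (C := 0) (c := 0) (s₁ := 3 / 4 + p / (4 * N)) (s₂ := 3 / 4 + q / (4 * N))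
    (A.map r).one_mem hhA le_rfl (by norm_num)
    (by have : 0 < (p : ℝ) / (4 * N) := div_pos hp0 hN0
        linarith)
    (by have := div_lt_div_of_pos_right hpq hN0
        linarith)
    (fun z => by
      have h1 := (r g₁).norm_coe_le_norm z
      rw [hr] at h1
      rw [hhz]
      refine (norm_add_le _ _).trans ?_
      rw [norm_mul, Complex.norm_real, Real.norm_of_nonneg (by positivity)]
      have h2 : 1 / (4 * N) * ‖g₁ z‖ ≤ 1 / 4 := by
        rw [one_div, inv_mul_le_iff₀ hN0]; linarith
      have h3 : ‖(3 / 4 : ℂ)‖ = 3 / 4 := by norm_num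
      linarith)
    (fun z => Or.inr (Or.inl (by simp)))
    (fun z h1 h2 => by
      rw [hre] at h1 h2
      rw [add_lt_add_iff_left, div_lt_div_iff_of_pos_right hN0] at h1 h2
      exact absurd ⟨h1.le, h2.le⟩ (hgap _ ⟨z, z.2, rfl⟩))
  obtain ⟨_, hg, hdist⟩ := Metric.mem_closure_iff.mp hθ (1 / 200) (by norm_num)
  obtain ⟨g, hgA, rfl⟩ := Subalgebra.mem_map.mp hg
  have hclose : ∀ z : F, ‖g z - θ z‖ ≤ 1 / 200 := fun z => by
    have h1 := (r g - θ).norm_coe_le_norm z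
    rw [dist_comm, dist_eq_norm] at hdist
    exact h1.trans hdist.le
  refine ⟨g, hgA, fun z hz => ?_, ?_, ?_⟩
  · have h1 := hclose ⟨z, hz⟩
    by_cases hc : 3 / 4 + q / (4 * N) ≤ (h ⟨z, hz⟩).re
    · rw [(hθ' _).1 hc (by simp)] at h1
      exact Or.inr h1
    · rw [(hθ' _).2 fun h => hc h.1, sub_zero] at h1
      exact Or.inl h1
  · have h1 := hclose ⟨x, hx⟩
    rwa [(hθ' _).2, sub_zero] at h1
    rintro ⟨h2, -⟩
    rw [hre, hg₁x, Complex.zero_re, zero_div] at h2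
    have : 0 < (q : ℝ) / (4 * N) := div_pos (hp0.trans hpq) hN0
    linarith
  · have h1 := hclose ⟨y, hy⟩
    rwa [(hθ' _).1 _ (by simp)] at h1
    rw [hre, hg₁y, Complex.one_re]
    have := div_lt_div_of_pos_right hq1 hN0
    linarith

/-! ### Peaking near the Šilov boundary -/

section Silov

variable {X : Type*} [TopologicalSpace X] [CompactSpace X]

theorem exists_mem_silovBoundary_norm_eq [Nonempty X] {A : Subalgebra ℂ C(X, ℂ)}
    (hA : A.SeparatesPoints) {f : C(X, ℂ)} (hf : f ∈ A) :
    ∃ x ∈ silovBoundary A, ‖f x‖ = ‖f‖ :=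
  ((isBoundary_iff A _).mp (silovBoundary_isLeast A hA).1).2 f hf

/-- An open set meeting the Šilov boundary supports, up to a small error, a function of the
algebra of norm one. -/
theorem exists_concentrated {A : Subalgebra ℂ C(X, ℂ)} (hA : A.SeparatesPoints) {W : Set X}
    (hW : IsOpen W) (hWS : (W ∩ silovBoundary A).Nonempty) {c : ℝ} (hc : 0 < c) :
    ∃ h ∈ A, (∀ x, ‖h x‖ ≤ 1) ∧ (∀ x, x ∉ W → ‖h x‖ ≤ c) ∧ ∃ x ∈ silovBoundary A, h x = 1 := by
  obtain ⟨w, hwW, hwS⟩ := hWS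
  have : Nonempty X := ⟨w⟩
  rcases (Wᶜ).eq_empty_or_nonempty with hemp | hne
  · refine ⟨1, A.one_mem, by simp, fun x hx => ?_, w, hwS, rfl⟩
    exact absurd (hemp ▸ hx : x ∈ (∅ : Set X)) (Set.notMem_empty x)
  have hnb : ¬ IsBoundary A Wᶜ := fun h => Set.sInter_subset_of_mem h hwS hwW
  rw [isBoundary_iff, not_and] at hnb
  have hnb' := hnb hW.isClosed_compl
  push Not at hnb'
  obtain ⟨f, hf, hfW⟩ := hnb'
  have hlt : ∀ y ∈ Wᶜ, ‖f y‖ < ‖f‖ := fun y hy => (f.norm_coe_le_norm y).lt_of_ne (hfW y hy)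
  obtain ⟨y₀, hy₀, hmax⟩ := hW.isClosed_compl.isCompact.exists_isMaxOn hne
    (f := fun x => ‖f x‖) (by fun_prop)
  have hpos : 0 < ‖f‖ := (norm_nonneg _).trans_lt (hlt y₀ hy₀)
  obtain ⟨x, hxS, hx⟩ := exists_mem_silovBoundary_norm_eq hA hf
  have hfx : f x ≠ 0 := norm_pos_iff.mp (hx ▸ hpos)
  -- After division by f x the modulus is at most 1, and bounded away from 1 off W, so a high power
  -- is at most c there.
  obtain ⟨n, hn⟩ := exists_pow_lt_of_lt_one hc ((div_lt_one hpos).mpr (hlt y₀ hy₀))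
  refine ⟨((f x)⁻¹ • f) ^ n, A.pow_mem (A.smul_mem hf _) n, fun z => ?_, fun z hz => ?_,
    x, hxS, ?_⟩
  · simp only [ContinuousMap.pow_apply, ContinuousMap.smul_apply, smul_eq_mul, norm_pow, norm_mul,
      norm_inv, hx]
    refine pow_le_one₀ (by positivity) ?_
    rw [inv_mul_le_iff₀ hpos, mul_one]
    exact f.norm_coe_le_norm z
  · simp only [ContinuousMap.pow_apply, ContinuousMap.smul_apply, smul_eq_mul, norm_pow, norm_mul,
      norm_inv, hx]
    refine le_trans (pow_le_pow_left₀ (by positivity) ?_ n) hn.le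
    rw [inv_mul_le_iff₀ hpos, mul_div_cancel₀ _ hpos.ne']
    exact hmax hz
  · simp [hfx]

/-- For an algebra with only trivial idempotents, no proper open set meets the Šilov boundary in
exactly one point. -/
theorem inter_silovBoundary_ne_singleton {A : Subalgebra ℂ C(X, ℂ)} (hA : A.SeparatesPoints)
    (hAc : IsClosed (A : Set C(X, ℂ))) (hAi : ∀ e ∈ A, IsIdempotentElem e → e = 0 ∨ e = 1)
    {W : Set X} (hW : IsOpen W) (hWu : W ≠ Set.univ) (x : X) : W ∩ silovBoundary A ≠ {x} := by
  intro hWx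
  have : Nonempty X := ⟨x⟩
  obtain ⟨h, hh, hle, hsmall, x', hx'S, hx'⟩ := exists_concentrated hA hW
    (hWx ▸ Set.singleton_nonempty x) (show (0 : ℝ) < 1 / 2 by norm_num)
  have hout : ∀ y ∈ silovBoundary A, y ≠ x → y ∉ W := fun y hy hyx hyW =>
    hyx (by simpa using (hWx ▸ ⟨hyW, hy⟩ : y ∈ ({x} : Set X)))
  have hx1 : h x = 1 := by
    by_cases hxx : x' = x
    · rw [← hxx, hx']
    · have h1 := hsmall x' (hout x' hx'S hxx)
      rw [hx', norm_one] at h1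
      norm_num at h1
  -- Norms in A are attained on the Šilov boundary, where h is 1 at x and at most 1/2 in modulus
  -- elsewhere. The limit of hⁿ is then idempotent.
  have hcau : CauchySeq fun n : ℕ => h ^ n := by
    refine cauchySeq_of_le_geometric (1 / 2) 2 (by norm_num) fun n => ?_
    rw [dist_eq_norm]
    obtain ⟨y, hyS, hy⟩ := exists_mem_silovBoundary_norm_eq hA
      (A.sub_mem (A.pow_mem hh n) (A.pow_mem hh (n + 1)))
    rw [← hy, ContinuousMap.sub_apply, ContinuousMap.pow_apply, ContinuousMap.pow_apply]
    by_cases hyx : y = x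
    · rw [hyx, hx1]; simp
    · have h1 := pow_le_pow_left₀ (norm_nonneg _) (hsmall y (hout y hyS hyx)) n
      have h2 : ‖1 - h y‖ ≤ 2 := by
        have h3 := norm_sub_le 1 (h y)
        rw [norm_one] at h3
        linarith [hle y]
      rw [pow_succ, ← mul_one_sub, norm_mul, norm_pow, mul_comm (2 : ℝ)]
      exact mul_le_mul h1 h2 (norm_nonneg _) (by positivity)
  obtain ⟨e, he⟩ := cauchySeq_tendsto_of_complete hcau
  have heA : e ∈ A := hAc.mem_of_tendsto he (Eventually.of_forall fun n => A.pow_mem hh n)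
  have hee : IsIdempotentElem e := by
    have h1 : Tendsto (fun n : ℕ => h ^ n * h ^ n) atTop (𝓝 (e * e)) := he.mul he
    have h2 : Tendsto (fun n : ℕ => h ^ n * h ^ n) atTop (𝓝 e) := by
      refine (he.comp (tendsto_id.const_mul_atTop' (show 0 < 2 by norm_num))).congr fun n => ?_
      simp only [Function.comp_apply, id]
      rw [two_mul, pow_add]
    exact tendsto_nhds_unique h1 h2
  have hev : ∀ y, Tendsto (fun n : ℕ => h y ^ n) atTop (𝓝 (e y)) := fun y => by
    have h1 := ((continuous_eval_const y : Continuous fun f : C(X, ℂ) => f y).tendsto e).comp he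
    exact h1
  have hex : e x = 1 := by
    refine tendsto_nhds_unique (hev x) ?_
    simp [hx1]
  obtain ⟨z, hz⟩ := (Set.ne_univ_iff_exists_notMem W).mp hWu
  have hez : e z = 0 := by
    refine tendsto_nhds_unique (hev z) (tendsto_pow_atTop_nhds_zero_of_norm_lt_one ?_)
    linarith [hsmall z hz]
  rcases hAi e heA hee with h0 | h0
  · rw [h0] at hex; simp at hex
  · rw [h0] at hez; simp at hez

end Silov

/-! ### Only countably many fibres are split -/

theorem sq_sub_near_zero {a b : ℂ} (h : ‖a‖ ≤ 1 / 100 ∧ ‖b‖ ≤ 1 / 100 ∨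
    ‖a - 1‖ ≤ 1 / 100 ∧ ‖b - 1‖ ≤ 1 / 100) : ‖(a - b) ^ 2‖ ≤ 1 / 20 := by
  have h1 : ‖a - b‖ ≤ 1 / 50 := by
    rcases h with ⟨h1, h2⟩ | ⟨h1, h2⟩
    · linarith [norm_sub_le a b]
    · have := norm_sub_le (a - 1) (b - 1)
      rw [sub_sub_sub_cancel_right] at this
      linarith
  rw [norm_pow]
  nlinarith [norm_nonneg (a - b)]

theorem sq_sub_near_one {a b : ℂ} (h : ‖a‖ ≤ 1 / 100 ∧ ‖b - 1‖ ≤ 1 / 100 ∨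
    ‖a - 1‖ ≤ 1 / 100 ∧ ‖b‖ ≤ 1 / 100) : ‖(a - b) ^ 2 - 1‖ ≤ 1 / 20 := by
  have key : ∀ a b : ℂ, ‖a‖ ≤ 1 / 100 → ‖b - 1‖ ≤ 1 / 100 → ‖(a - b) ^ 2 - 1‖ ≤ 1 / 20 := by
    intro a b ha hb
    have h1 := norm_sub_le a (b - 1)
    have h2 := norm_sub_le (a - (b - 1)) 2
    have h3 : ‖(2 : ℂ)‖ = 2 := by norm_num
    rw [show (a - b) ^ 2 - 1 = (a - (b - 1)) * (a - (b - 1) - 2) by ring, norm_mul]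
    calc _ ≤ (1 / 50 : ℝ) * (1 / 50 + 2) :=
          mul_le_mul (by linarith) (by linarith) (norm_nonneg _) (by norm_num)
      _ ≤ 1 / 20 := by norm_num
  rcases h with ⟨h1, h2⟩ | ⟨h1, h2⟩
  · exact key a b h1 h2
  · rw [show (a - b) ^ 2 = (b - a) ^ 2 by ring]
    exact key b a h2 h1

section Split

variable {X Y : Type*} [TopologicalSpace X] [CompactSpace X] [MetricSpace Y]

/-- The values `y` of `φ` for which some function of the algebra, of norm at most `k` and close to
an indicator function on the part of `K` where `φ` is `1 / (k + 1)`-close to `y`, splits the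
part of the fibre over `y` inside `V`. -/
def splitValues (A : Subalgebra ℂ C(X, ℂ)) (K : Set X) (φ : X → Y) (k : ℕ) (V : Set X) : Set Y :=
  {y | ∃ g ∈ A, ‖g‖ ≤ k ∧
    (∀ x ∈ K, dist (φ x) y < 1 / (k + 1) → ‖g x‖ ≤ 1 / 100 ∨ ‖g x - 1‖ ≤ 1 / 100) ∧
    ∃ x₁ ∈ V, ∃ x₂ ∈ V, φ x₁ = y ∧ φ x₂ = y ∧ ‖g x₁‖ ≤ 1 / 100 ∧ ‖g x₂ - 1‖ ≤ 1 / 100}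

theorem not_near_both {z : ℂ} (h0 : ‖z‖ ≤ 1 / 100) (h1 : ‖z - 1‖ ≤ 1 / 100) : False := by
  have := norm_sub_le z (z - 1)
  rw [sub_sub_cancel, norm_one] at this
  linarith

/-- If `g` is close to an indicator function on `W` then there is a level strip of `h` on which `g`
does not split any fibre of `φ`. -/
theorem exists_strip_not_splitting {K W : Set X} {φ : X → Y} (hφ : Continuous φ)
    (hK : IsClosed K) (hsc : ∀ y, IsScattered (K ∩ φ ⁻¹' {y})) (hWK : W ⊆ K) {g h : C(X, ℂ)}
    (hg : {y | ∃ x₁ ∈ K, ∃ x₂ ∈ K, φ x₁ = y ∧ φ x₂ = y ∧ g x₁ ≠ g x₂}.Countable)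
    (hhW : ∀ x, 1 / 2 ≤ (h x).re → x ∈ W) {b : ℝ} (hb : 1 / 2 < b) :
    ∃ p q : ℚ, (1 / 2 : ℝ) < p ∧ (p : ℝ) < q ∧ (q : ℝ) < b ∧
      Disjoint (φ '' {x | (p ≤ (h x).re ∧ (h x).re ≤ q) ∧ ‖g x‖ ≤ 1 / 100})
        (φ '' {x | (p ≤ (h x).re ∧ (h x).re ≤ q) ∧ ‖g x - 1‖ ≤ 1 / 100}) := by
  have hre : Continuous fun x => (h x).re := by fun_prop
  -- Pairs in a common fibre that g splits. A gap in the values of Re h at first coordinates is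
  -- already enough.
  set Ξ : Set (X × X) := {z | (1 / 2 ≤ (h z.1).re ∧ 1 / 2 ≤ (h z.2).re) ∧ φ z.1 = φ z.2 ∧
    ‖g z.1‖ ≤ 1 / 100 ∧ ‖g z.2 - 1‖ ≤ 1 / 100} with hΞ
  have hΞc : IsClosed Ξ := by
    refine ((isClosed_le continuous_const (hre.comp continuous_fst)).inter
      (isClosed_le continuous_const (hre.comp continuous_snd))).inter
      ((isClosed_eq (hφ.comp continuous_fst) (hφ.comp continuous_snd)).inter
      ((isClosed_le (f := fun z : X × X => ‖g z.1‖) (by fun_prop) continuous_const).inter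
      (isClosed_le (f := fun z : X × X => ‖g z.2 - 1‖) (by fun_prop) continuous_const)))
  have hS : IsClosed ((fun z : X × X => (h z.1).re) '' Ξ) :=
    (hΞc.isCompact.image (hre.comp continuous_fst)).isClosed
  have hF : ∀ y, IsCompact (K ∩ φ ⁻¹' {y}) := fun y =>
    (hK.inter (isClosed_singleton.preimage hφ)).isCompact
  -- Those values come from the countably many fibres on which g is not constant; each contributes a
  -- closed set without interior, so Baire applies.
  have hS' : interior ((fun z : X × X => (h z.1).re) '' Ξ) = ∅ := by
    refine Set.subset_eq_empty (interior_mono ?_) (interior_biUnion_eq_empty hg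
      (C := fun y => (fun x => (h x).re) '' (K ∩ φ ⁻¹' {y}))
      (fun y _ => ((hF y).image hre).isClosed)
      (fun y _ => (hsc y).interior_image_eq_empty (hF y) hre))
    rintro _ ⟨⟨x, x'⟩, ⟨⟨h1, h2⟩, h3, h4, h5⟩, rfl⟩
    have hxK := hWK (hhW x h1)
    refine Set.mem_biUnion (x := φ x) ⟨x, hxK, x', hWK (hhW x' h2), rfl, h3.symm, fun heq => ?_⟩
      ⟨x, ⟨hxK, rfl⟩, rfl⟩
    exact not_near_both h4 (heq ▸ h5)
  obtain ⟨p, q, hp, hpq, hq, hgap⟩ := exists_rat_gap hS hS' hb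
  refine ⟨p, q, hp, hpq, hq, Set.disjoint_left.mpr ?_⟩
  rintro _ ⟨x, ⟨⟨h1, h2⟩, h3⟩, rfl⟩ ⟨x', ⟨⟨h4, h5⟩, h6⟩, h7⟩
  exact hgap _ ⟨(x, x'), ⟨⟨hp.le.trans h1, hp.le.trans h4⟩, h7.symm, h3, h6⟩, rfl⟩ ⟨h1, h2⟩

/-- Each split value is tagged with a rational strip and a set B from a countable family that
records which fibres carry g ≈ 1 on the strip. Uncountably many values with one tag would yield
functions g, g' equal up to small error on the strip, and a further-in point where (g - g')² ≈ 1;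
cutting gives a nontrivial idempotent. -/
theorem countable_splitValues [T2Space X] [SecondCountableTopology Y] {A : Subalgebra ℂ C(X, ℂ)}
    (hAc : IsClosed (A : Set C(X, ℂ))) (hAi : ∀ e ∈ A, IsIdempotentElem e → e = 0 ∨ e = 1)
    {K W : Set X} {φ : X → Y} (hφ : Continuous φ) (hK : IsClosed K)
    (hsc : ∀ y, IsScattered (K ∩ φ ⁻¹' {y}))
    (hconst : ∀ g : C(X, ℂ),
      {y | ∃ x₁ ∈ K, ∃ x₂ ∈ K, φ x₁ = y ∧ φ x₂ = y ∧ g x₁ ≠ g x₂}.Countable)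
    (hWK : W ⊆ K) (hWu : W ≠ Set.univ) {k : ℕ}
    (hdiam : ∀ x ∈ W, ∀ x' ∈ W, dist (φ x) (φ x') < 1 / (k + 1))
    {h : C(X, ℂ)} (hh : h ∈ A) (hle : ∀ x, ‖h x‖ ≤ 1) {c : ℝ} (hc : 0 ≤ c)
    (hck : (2 * (2 * k) ^ 2 + 1) ^ 2 * c ≤ 1 / 4) (hsmall : ∀ x, x ∉ W → ‖h x‖ ≤ c) :
    (splitValues A K φ k {x | 1 / 2 < (h x).re}).Countable := by
  have hc4 : c ≤ 1 / 4 := by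
    have : (1 : ℝ) ≤ (2 * (2 * k) ^ 2 + 1) ^ 2 := one_le_pow₀ (by nlinarith [sq_nonneg (2 * k : ℝ)])
    nlinarith
  have hhW : ∀ x, 1 / 2 ≤ (h x).re → x ∈ W := fun x hx => by
    by_contra hxW
    linarith [hsmall x hxW, Complex.re_le_norm (h x)]
  obtain ⟨𝓕, h𝓕, hsep⟩ := exists_countable_separating_compacts Y
  let P : ℚ → ℚ → Set Y → Set Y := fun p q B => {y | ((1 / 2 : ℝ) < p ∧ (p : ℝ) < q) ∧
    ∃ g ∈ A, ‖g‖ ≤ k ∧ (∀ x ∈ W, ‖g x‖ ≤ 1 / 100 ∨ ‖g x - 1‖ ≤ 1 / 100) ∧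
    (∃ x₁ x₂, (q : ℝ) ≤ (h x₁).re ∧ (q : ℝ) ≤ (h x₂).re ∧ φ x₁ = y ∧ φ x₂ = y ∧
      ‖g x₁‖ ≤ 1 / 100 ∧ ‖g x₂ - 1‖ ≤ 1 / 100) ∧
    ∀ x, p ≤ (h x).re → (h x).re ≤ q →
      (‖g x‖ ≤ 1 / 100 → φ x ∉ B) ∧ (‖g x - 1‖ ≤ 1 / 100 → φ x ∈ B)}
  have hcover : splitValues A K φ k {x | 1 / 2 < (h x).re} ⊆ ⋃ p, ⋃ q, ⋃ B ∈ 𝓕, P p q B := by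
    rintro y ⟨g, hg, hgk, hgn, x₁, hx₁, x₂, hx₂, hy₁, hy₂, hg₁, hg₂⟩
    have hx₁' : (1 / 2 : ℝ) < (h x₁).re := hx₁
    have hx₂' : (1 / 2 : ℝ) < (h x₂).re := hx₂
    obtain ⟨p, q, hp, hpq, hq, hdisj⟩ := exists_strip_not_splitting hφ hK hsc hWK (hconst g) hhW
      (lt_min hx₁' hx₂')
    have hre : Continuous fun x => (h x).re := by fun_prop
    have hstrip : IsClosed {x | (p : ℝ) ≤ (h x).re ∧ (h x).re ≤ q} :=
      (isClosed_le continuous_const hre).inter (isClosed_le hre continuous_const)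
    obtain ⟨B, hB, hB1, hB0⟩ := hsep _ _
      ((hstrip.inter (isClosed_le (f := fun x => ‖g x‖) (by fun_prop)
        (continuous_const (y := (1 / 100 : ℝ))))).isCompact.image hφ)
      ((hstrip.inter (isClosed_le (f := fun x => ‖g x - 1‖) (by fun_prop)
        (continuous_const (y := (1 / 100 : ℝ))))).isCompact.image hφ) hdisj
    simp only [Set.mem_iUnion]
    refine ⟨p, q, B, hB, ⟨hp, hpq⟩, g, hg, hgk, fun x hx => ?_,
      ⟨x₁, x₂, hq.le.trans (min_le_left _ _), hq.le.trans (min_le_right _ _), hy₁, hy₂, hg₁, hg₂⟩,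
      fun x h1 h2 => ⟨fun h3 h4 => ?_, fun h3 => hB1 ⟨x, ⟨⟨h1, h2⟩, h3⟩, rfl⟩⟩⟩
    · exact hgn x (hWK hx) (hy₁ ▸ hdiam x hx x₁ (hhW x₁ hx₁'.le))
    · exact Set.disjoint_left.mp hB0 ⟨x, ⟨⟨h1, h2⟩, h3⟩, rfl⟩ h4
  refine Set.Countable.mono hcover (Set.countable_iUnion fun p => Set.countable_iUnion fun q =>
    h𝓕.biUnion fun B _ => ?_)
  by_contra hunc
  obtain ⟨y, ⟨hp, hpq⟩, g, hg, hgk, hgn, -, hgB⟩ : (P p q B).Nonempty := by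
    by_contra hne
    exact hunc (Set.not_nonempty_iff_eq_empty.mp hne ▸ Set.countable_empty)
  -- The first function g is nonconstant on only countably many fibres, so some z with the same tag
  -- has g constant on its fibre while g' splits it.
  obtain ⟨z, ⟨-, g', hg', hgk', hgn', ⟨x₁, x₂, hx₁, hx₂, hz₁, hz₂, hg₁, hg₂⟩, hgB'⟩, hzbad⟩ :
      (P p q B \ {y | ∃ x₁ ∈ K, ∃ x₂ ∈ K, φ x₁ = y ∧ φ x₂ = y ∧ g x₁ ≠ g x₂}).Nonempty := by
    by_contra hne
    exact hunc ((hconst g).mono (Set.sdiff_eq_empty.mp (Set.not_nonempty_iff_eq_empty.mp hne)))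
  have hx₁W : x₁ ∈ W := hhW x₁ (by linarith)
  have hx₂W : x₂ ∈ W := hhW x₂ (by linarith)
  have hgg : g x₁ = g x₂ := by
    by_contra hne
    exact hzbad ⟨x₁, hWK hx₁W, x₂, hWK hx₂W, hz₁, hz₂, hne⟩
  have he : ∀ x, ((g - g') ^ 2) x = (g x - g' x) ^ 2 := fun _ => rfl
  have hnorm : ∀ x, ‖((g - g') ^ 2) x‖ ≤ (2 * k) ^ 2 := fun x => by
    rw [he, norm_pow]
    refine pow_le_pow_left₀ (norm_nonneg _) ?_ 2
    linarith [norm_sub_le (g x) (g' x), g.norm_coe_le_norm x, g'.norm_coe_le_norm x]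
  obtain ⟨θ, hθ, hθ'⟩ := exists_indicator_mem_closure A (e := (g - g') ^ 2) (h := h)
    (C := (2 * k) ^ 2) (c := c) (s₁ := p) (s₂ := q) (A.pow_mem (A.sub_mem hg hg') 2) hh hc hck
    hp.le hpq hle (fun x => by
      by_cases hxW : x ∈ W
      · rw [he]
        rcases hgn x hxW with h1 | h1 <;> rcases hgn' x hxW with h2 | h2
        · exact Or.inl (sq_sub_near_zero (Or.inl ⟨h1, h2⟩))
        · exact Or.inr (Or.inl (sq_sub_near_one (Or.inl ⟨h1, h2⟩)))
        · exact Or.inr (Or.inl (sq_sub_near_one (Or.inr ⟨h1, h2⟩)))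
        · exact Or.inl (sq_sub_near_zero (Or.inr ⟨h1, h2⟩))
      · exact Or.inr (Or.inr ⟨hnorm x, hsmall x hxW⟩))
    (fun x h1 h2 => by
      have hxW : x ∈ W := hhW x (by linarith)
      obtain ⟨b0, b1⟩ := hgB x h1.le h2.le
      obtain ⟨b0', b1'⟩ := hgB' x h1.le h2.le
      rw [he]
      rcases hgn x hxW with h1 | h1 <;> rcases hgn' x hxW with h2 | h2
      · exact sq_sub_near_zero (Or.inl ⟨h1, h2⟩)
      · exact absurd (b1' h2) (b0 h1)
      · exact absurd (b1 h1) (b0' h2)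
      · exact sq_sub_near_zero (Or.inr ⟨h1, h2⟩))
  rw [hAc.closure_eq] at hθ
  have hid : IsIdempotentElem θ := by
    ext x
    rw [ContinuousMap.mul_apply]
    by_cases hx : (q : ℝ) ≤ (h x).re ∧ ‖((g - g') ^ 2) x - 1‖ ≤ 1 / 20
    · rw [(hθ' x).1 hx.1 hx.2, mul_one]
    · rw [(hθ' x).2 hx, mul_zero]
  obtain ⟨w, hw⟩ := (Set.ne_univ_iff_exists_notMem W).mp hWu
  have hθw : θ w = 0 := (hθ' w).2 fun h1 => hw (hhW w (by linarith [h1.1]))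
  -- As g has equal values at x₁ and x₂ while g' is near 0 and near 1 respectively, g and g' differ
  -- by about 1 at one of the two.
  obtain ⟨x, hx⟩ : ∃ x, θ x = 1 := by
    rcases hgn x₁ hx₁W with h1 | h1
    · refine ⟨x₂, (hθ' x₂).1 hx₂ ?_⟩
      rw [he, ← hgg]
      exact sq_sub_near_one (Or.inl ⟨h1, hg₂⟩)
    · exact ⟨x₁, (hθ' x₁).1 hx₁ (sq_sub_near_one (Or.inr ⟨h1, hg₁⟩))⟩
  rcases hAi θ hθ hid with h0 | h0
  · rw [h0] at hx; simp at hx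
  · rw [h0] at hθw; simp at hθw

end Split

/-! ### Transporting the nice family -/

/-- A nice space embedded as a closed subset `K` of a normal space `X` yields a continuous map on
`X` into a metrizable space whose fibres in `K` behave like the fibres of a nice family. -/
theorem IsNice.exists_fibre_map {H X : Type*} [TopologicalSpace H] [NormalSpace H]
    [TopologicalSpace X] [NormalSpace X] (hH : IsNice H) {K : Set X} (hK : IsClosed K)
    {ι : K → H} (hι : IsClosedEmbedding ι) :
    ∃ φ : C(X, ℕ → ℂ), (∀ y, IsScattered (K ∩ φ ⁻¹' {y})) ∧ ∀ g : C(X, ℂ),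
      {y | ∃ x₁ ∈ K, ∃ x₂ ∈ K, φ x₁ = y ∧ φ x₂ = y ∧ g x₁ ≠ g x₂}.Countable := by
  obtain ⟨E, hE, hEn⟩ := hH
  obtain ⟨F, hF⟩ : ∃ F : ℕ → C(H, ℂ), ∀ x y, (∀ n, F n x = F n y) ↔ ∀ f ∈ E, f x = f y := by
    rcases E.eq_empty_or_nonempty with rfl | hne
    · exact ⟨fun _ => 0, by simp⟩
    · obtain ⟨F, rfl⟩ := hE.exists_eq_range hne
      exact ⟨F, by simp⟩
  obtain ⟨φ, hφ⟩ := ContinuousMap.exists_extension (Y := ℕ → ℂ) hK.isClosedEmbedding_subtypeVal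
    ⟨fun x n => F n (ι x), continuous_pi fun n => (F n).continuous.comp hι.continuous⟩
  have hφ' : ∀ x : K, φ x = fun n => F n (ι x) := fun x => congrArg (fun f => f x) hφ
  have hclass : ∀ z : H, {w | ∀ f ∈ E, f w = f z} ∈ (fibreSetoid E).classes := fun z => ⟨z, rfl⟩
  refine ⟨φ, fun y T hT hTne => ?_, fun g => ?_⟩
  · obtain ⟨t₀, ht₀⟩ := hTne
    set T' : Set H := ι '' {x | (x : X) ∈ T}
    obtain ⟨_, ⟨x, hxT, rfl⟩, O, hO, hOT⟩ := hEn.scattered _ (hclass (ι ⟨t₀, (hT ht₀).1⟩)) T'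
      (by
        rintro _ ⟨x, hx, rfl⟩
        refine (hF _ _).mp fun n => ?_
        have h1 : φ x = y := (hT hx).2
        have h2 : φ t₀ = y := (hT ht₀).2
        rw [hφ' x] at h1
        rw [show t₀ = ((⟨t₀, (hT ht₀).1⟩ : K) : X) from rfl, hφ'] at h2
        exact congrFun (h1.trans h2.symm) n)
      ⟨_, ⟨⟨t₀, (hT ht₀).1⟩, ht₀, rfl⟩⟩
    obtain ⟨O', hO', hOO'⟩ := isOpen_induced_iff.mp (hO.preimage hι.continuous)
    have hmem : ∀ z : K, (z : X) ∈ O' ↔ ι z ∈ O := fun z => by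
      rw [← Set.mem_preimage (f := ι), ← hOO']; rfl
    refine ⟨x, hxT, O', hO', ?_⟩
    ext z
    rw [Set.mem_singleton_iff]
    constructor
    · rintro ⟨hz, hzT⟩
      have h1 : ι ⟨z, (hT hzT).1⟩ ∈ O ∩ T' := ⟨(hmem _).mp hz, ⟨_, hzT, rfl⟩⟩
      rw [hOT] at h1
      exact congrArg Subtype.val (hι.injective h1)
    · rintro rfl
      exact ⟨(hmem x).mpr (hOT.ge rfl).1, hxT⟩
  · obtain ⟨G, hG⟩ := ContinuousMap.exists_extension (Y := ℂ) hι (g.restrict K)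
    have hG' : ∀ x : K, G (ι x) = g x := fun x => congrArg (fun f => f x) hG
    classical
    -- A fibre of the family determines its value under φ, so bad values are images of bad fibres.
    -- The default 0 is never used, since classes are nonempty.
    refine ((hEn.constant G).image fun s : Set H =>
      if hs : s.Nonempty then fun n => F n hs.some else 0).mono ?_
    rintro y ⟨x₁, hx₁, x₂, hx₂, h1, h2, hne⟩
    rw [show x₁ = ((⟨x₁, hx₁⟩ : K) : X) from rfl, hφ'] at h1
    rw [show x₂ = ((⟨x₂, hx₂⟩ : K) : X) from rfl, hφ'] at h2
    set s : Set H := {w | ∀ f ∈ E, f w = f (ι ⟨x₁, hx₁⟩)} with hs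
    have hm₁ : ι ⟨x₁, hx₁⟩ ∈ s := fun _ _ => rfl
    have hm₂ : ι ⟨x₂, hx₂⟩ ∈ s := (hF _ _).mp fun n => congrFun (h2.trans h1.symm) n
    refine ⟨s, ⟨hclass _, ?_⟩, ?_⟩
    · rintro ⟨z, hz⟩
      have e₁ : G (ι ⟨x₁, hx₁⟩) = z := hz.le ⟨_, hm₁, rfl⟩
      have e₂ : G (ι ⟨x₂, hx₂⟩) = z := hz.le ⟨_, hm₂, rfl⟩
      rw [hG'] at e₁ e₂
      exact hne (e₁.trans e₂.symm)
    · have hsne : s.Nonempty := ⟨_, hm₁⟩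
      simp only [dif_pos hsne]
      rw [← h1]
      funext n
      exact (hF _ _).mpr hsne.some_mem n

/-! ### The tree of open sets and its branches -/

section Tree

variable {X Y : Type*} [TopologicalSpace X] [CompactSpace X] [T2Space X] [MetricSpace Y]

/-- Take V = {Re h > 1/2} for h concentrated on a small neighbourhood of a Šilov boundary point. The
smallness 1/(4D) offsets the growth D = (2C + 1)² for C = (2k)², which bounds (g - g')² when g and
g' have norm at most k. -/
theorem exists_shrink [SecondCountableTopology Y] {A : Subalgebra ℂ C(X, ℂ)} (hA : A.SeparatesPoints)
    (hAc : IsClosed (A : Set C(X, ℂ))) (hAi : ∀ e ∈ A, IsIdempotentElem e → e = 0 ∨ e = 1)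
    {K : Set X} {φ : X → Y} (hφ : Continuous φ) (hK : IsClosed K)
    (hsc : ∀ y, IsScattered (K ∩ φ ⁻¹' {y}))
    (hconst : ∀ g : C(X, ℂ),
      {y | ∃ x₁ ∈ K, ∃ x₂ ∈ K, φ x₁ = y ∧ φ x₂ = y ∧ g x₁ ≠ g x₂}.Countable)
    {W : Set X} (hW : IsOpen W) (hWK : W ⊆ K) (hWu : W ≠ Set.univ)
    (hWS : (W ∩ silovBoundary A).Nonempty) (k : ℕ) :
    ∃ V : Set X, IsOpen V ∧ closure V ⊆ W ∧ (V ∩ silovBoundary A).Nonempty ∧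
      (∀ x ∈ V, ∀ x' ∈ V, dist (φ x) (φ x') < 1 / (k + 1)) ∧ (splitValues A K φ k V).Countable := by
  obtain ⟨x, hxW, hxS⟩ := hWS
  have hr : (0 : ℝ) < 1 / (k + 1) / 2 := by positivity
  have hO : IsOpen (W ∩ φ ⁻¹' Metric.ball (φ x) (1 / (k + 1) / 2)) :=
    hW.inter (Metric.isOpen_ball.preimage hφ)
  obtain ⟨t, ht, htc, htO⟩ := exists_mem_nhds_isClosed_subset
    (hO.mem_nhds ⟨hxW, Metric.mem_ball_self hr⟩)
  obtain ⟨O, hOt, hOo, hxO⟩ := mem_nhds_iff.mp ht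
  have hOW := (closure_minimal hOt htc).trans htO
  set D : ℝ := (2 * (2 * k) ^ 2 + 1) ^ 2 with hD
  have hD0 : 0 < D := by positivity
  obtain ⟨h, hh, hle, hsmall, z, hzS, hz⟩ := exists_concentrated hA hOo ⟨x, hxO, hxS⟩
    (show 0 < 1 / (4 * D) by positivity)
  have hDc : D * (1 / (4 * D)) ≤ 1 / 4 := by
    rw [mul_one_div, mul_comm 4 D, ← div_div, div_self hD0.ne']
  have hVO : {x | 1 / 2 < (h x).re} ⊆ O := fun w hw => by
    by_contra hwO
    have h1 := hsmall w hwO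
    have h2 : (1 : ℝ) ≤ D := one_le_pow₀ (by nlinarith [sq_nonneg (2 * k : ℝ)])
    have h3 : (1 : ℝ) / (4 * D) ≤ 1 / 4 := one_div_le_one_div_of_le (by norm_num) (by linarith)
    have h4 : (1 : ℝ) / 2 < (h w).re := hw
    linarith [Complex.re_le_norm (h w)]
  have hOd : ∀ x ∈ O, ∀ x' ∈ O, dist (φ x) (φ x') < 1 / (k + 1) := fun u hu v hv => by
    have h1 : dist (φ u) (φ x) < 1 / (k + 1) / 2 := (hOW (subset_closure hu)).2
    have h2 : dist (φ v) (φ x) < 1 / (k + 1) / 2 := (hOW (subset_closure hv)).2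
    linarith [dist_triangle_right (φ u) (φ v) (φ x)]
  have hOsub : O ⊆ W := fun u hu => (hOW (subset_closure hu)).1
  refine ⟨{x | 1 / 2 < (h x).re}, isOpen_lt continuous_const (by fun_prop), ?_, ⟨z, ?_, hzS⟩, ?_, ?_⟩
  · exact (closure_mono hVO).trans (hOW.trans Set.inter_subset_left)
  · change (1 : ℝ) / 2 < (h z).re
    rw [hz]; norm_num
  · exact fun u hu v hv => hOd u (hVO hu) v (hVO hv)
  · exact countable_splitValues hAc hAi hφ hK hsc hconst (hOsub.trans hWK)
      (fun h1 => hWu (Set.univ_subset_iff.mp (h1 ▸ hOsub))) hOd hh hle (by positivity) hDc hsmall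

/-- If φ were constant on the part of the Šilov boundary in W, that part would lie in a scattered
fibre and have an isolated point, which is impossible. Two boundary points with distinct φ-values
seed the two branches. -/
theorem exists_fork [SecondCountableTopology Y] {A : Subalgebra ℂ C(X, ℂ)} (hA : A.SeparatesPoints)
    (hAc : IsClosed (A : Set C(X, ℂ))) (hAi : ∀ e ∈ A, IsIdempotentElem e → e = 0 ∨ e = 1)
    {K : Set X} {φ : X → Y} (hφ : Continuous φ) (hK : IsClosed K)
    (hsc : ∀ y, IsScattered (K ∩ φ ⁻¹' {y}))
    (hconst : ∀ g : C(X, ℂ),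
      {y | ∃ x₁ ∈ K, ∃ x₂ ∈ K, φ x₁ = y ∧ φ x₂ = y ∧ g x₁ ≠ g x₂}.Countable)
    {W : Set X} (hW : IsOpen W) (hWK : W ⊆ K) (hWu : W ≠ Set.univ)
    (hWS : (W ∩ silovBoundary A).Nonempty) (k : ℕ) :
    ∃ V : Bool → Set X, (∀ i, IsOpen (V i) ∧ closure (V i) ⊆ W ∧
      (V i ∩ silovBoundary A).Nonempty ∧
      (∀ x ∈ V i, ∀ x' ∈ V i, dist (φ x) (φ x') < 1 / (k + 1)) ∧
      (splitValues A K φ k (V i)).Countable) ∧ Disjoint (φ '' V true) (φ '' V false) := by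
  obtain ⟨x₀, hx₀, x₁, hx₁, hne⟩ : ∃ x₀ ∈ W ∩ silovBoundary A, ∃ x₁ ∈ W ∩ silovBoundary A,
      φ x₀ ≠ φ x₁ := by
    by_contra! hcon
    obtain ⟨x₀, hx₀⟩ := hWS
    obtain ⟨x, hx, O, hO, hOx⟩ := hsc (φ x₀) (W ∩ silovBoundary A)
      (fun x hx => ⟨hWK hx.1, hcon x hx x₀ hx₀⟩) ⟨x₀, hx₀⟩
    refine inter_silovBoundary_ne_singleton hA hAc hAi (hO.inter hW)
      (fun h => hWu (Set.univ_subset_iff.mp (h ▸ Set.inter_subset_right))) x ?_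
    rw [Set.inter_assoc, hOx]
  obtain ⟨O₀, O₁, hO₀, hO₁, hm₀, hm₁, hd⟩ := t2_separation hne
  have key : ∀ O : Set Y, IsOpen O → (∃ x ∈ W ∩ silovBoundary A, φ x ∈ O) →
      ∃ V : Set X, (IsOpen V ∧ closure V ⊆ W ∧ (V ∩ silovBoundary A).Nonempty ∧
        (∀ x ∈ V, ∀ x' ∈ V, dist (φ x) (φ x') < 1 / (k + 1)) ∧
        (splitValues A K φ k V).Countable) ∧ φ '' V ⊆ O := by
    rintro O hO ⟨x, ⟨hxW, hxS⟩, hxO⟩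
    obtain ⟨V, h1, h2, h3⟩ := exists_shrink hA hAc hAi hφ hK hsc hconst
      (hW.inter (hO.preimage hφ)) (Set.inter_subset_left.trans hWK)
      (fun h => hWu (Set.univ_subset_iff.mp (h ▸ Set.inter_subset_left))) ⟨x, ⟨hxW, hxO⟩, hxS⟩ k
    refine ⟨V, ⟨h1, h2.trans Set.inter_subset_left, h3⟩, ?_⟩
    rintro _ ⟨v, hv, rfl⟩
    exact (h2 (subset_closure hv)).2
  obtain ⟨V₀, h₀, h₀'⟩ := key O₀ hO₀ ⟨x₀, hx₀, hm₀⟩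
  obtain ⟨V₁, h₁, h₁'⟩ := key O₁ hO₁ ⟨x₁, hx₁, hm₁⟩
  refine ⟨fun i => if i then V₀ else V₁, fun i => ?_, ?_⟩
  · cases i
    · simpa using h₁
    · simpa using h₀
  · simpa using Set.disjoint_of_subset h₀' h₁' hd

/-- A function splitting a fibre of `φ` in `K` splits it, for large `k`, in the sense of
`splitValues`. -/
theorem exists_mem_splitValues {A : Subalgebra ℂ C(X, ℂ)} (hA : A.SeparatesPoints)
    {K : Set X} {φ : X → Y} (hφ : Continuous φ) (hK : IsClosed K)
    (hsc : ∀ y, IsScattered (K ∩ φ ⁻¹' {y})) {x x' : X} (hx : x ∈ K) (hx' : x' ∈ K)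
    (hxx : x ≠ x') (hφx : φ x = φ x') :
    ∃ k : ℕ, ∀ V : Set X, x ∈ V → x' ∈ V → φ x ∈ splitValues A K φ k V := by
  have hF : IsCompact (K ∩ φ ⁻¹' {φ x}) := (hK.inter (isClosed_singleton.preimage hφ)).isCompact
  obtain ⟨g, hg, hgn, hgx, hgx'⟩ := exists_near_indicator A hA hF (hsc _) ⟨hx, rfl⟩
    ⟨hx', hφx.symm⟩ hxx
  have hN : IsOpen ({z | ‖g z‖ < 1 / 100} ∪ {z | ‖g z - 1‖ < 1 / 100}) :=
    (isOpen_lt (by fun_prop) continuous_const).union (isOpen_lt (by fun_prop) continuous_const)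
  -- By compactness, being near 0 or 1 on the fibre persists on all fibres over a small ball;
  -- tolerance 1/200 was chosen to leave room within 1/100.
  have hcl : IsClosed (φ '' (K \ ({z | ‖g z‖ < 1 / 100} ∪ {z | ‖g z - 1‖ < 1 / 100}))) :=
    ((hK.sdiff hN).isCompact.image hφ).isClosed
  obtain ⟨ε, hε, hball⟩ := Metric.isOpen_iff.mp hcl.isOpen_compl (φ x) (by
    rintro ⟨z, ⟨hzK, hzN⟩, hzx⟩
    refine hzN ?_
    rcases hgn z ⟨hzK, hzx⟩ with h | h
    · exact Or.inl (lt_of_le_of_lt h (by norm_num))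
    · exact Or.inr (lt_of_le_of_lt h (by norm_num)))
  obtain ⟨n, hn⟩ := exists_nat_one_div_lt hε
  obtain ⟨m, hm⟩ := exists_nat_ge ‖g‖
  -- Here n makes the radius small enough and m bounds the norm of g.
  refine ⟨max n m, fun V hxV hxV' => ⟨g, hg, hm.trans (by exact_mod_cast le_max_right n m),
    fun z hz hzd => ?_, x, hxV, x', hxV', rfl, hφx.symm, hgx.trans (by norm_num),
    hgx'.trans (by norm_num)⟩⟩
  have h1 : (1 : ℝ) / ((max n m : ℕ) + 1) ≤ 1 / (n + 1) := by
    refine one_div_le_one_div_of_le (by positivity) ?_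
    have : (n : ℝ) ≤ (max n m : ℕ) := by exact_mod_cast le_max_left n m
    linarith
  by_contra hnear
  refine hball (Metric.mem_ball.mpr (hzd.trans (h1.trans_lt hn))) ⟨z, ⟨hz, fun hzN => hnear ?_⟩, rfl⟩
  exact hzN.imp (fun h => le_of_lt h) fun h => le_of_lt h

/-- Diagonalization gives a sequence a that is not the even part of any element of S; J places a on
the even coordinates and its argument on the odd ones. -/
theorem exists_interleaving_notMem {S : Set (ℕ → Bool)} (hS : S.Countable) :
    ∃ J : (ℕ → Bool) → (ℕ → Bool), Continuous J ∧ J.Injective ∧ ∀ b, J b ∉ S := by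
  obtain ⟨a, ha⟩ : ∃ a, a ∉ (fun (b : ℕ → Bool) n => b (2 * n)) '' S := by
    rcases S.eq_empty_or_nonempty with rfl | hne
    · exact ⟨0, by simp⟩
    obtain ⟨f, rfl⟩ := hS.exists_eq_range hne
    refine ⟨fun n => !(f n (2 * n)), ?_⟩
    rintro ⟨_, ⟨n, rfl⟩, hn⟩
    exact (Bool.not_ne_self _) (congrFun hn n).symm
  refine ⟨fun b n => if n % 2 = 0 then a (n / 2) else b (n / 2), ?_, fun b b' h => ?_, fun b hb => ?_⟩
  · refine continuous_pi fun n => ?_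
    split_ifs
    · exact continuous_const
    · exact continuous_apply _
  · funext n
    have := congrFun h (2 * n + 1)
    simpa [Nat.add_mod, show (2 * n + 1) / 2 = n by omega] using this
  · exact ha ⟨_, hb, by funext n; simp⟩

/-- If an algebra with only trivial idempotents has a Šilov boundary point in the interior of a set
`K` with scattered fibres over a metrizable space, then `K` contains a Cantor set. -/
theorem exists_cantor_embedding [SecondCountableTopology Y] {A : Subalgebra ℂ C(X, ℂ)} (hA : A.SeparatesPoints)
    (hAc : IsClosed (A : Set C(X, ℂ))) (hAi : ∀ e ∈ A, IsIdempotentElem e → e = 0 ∨ e = 1)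
    {K : Set X} {φ : X → Y} (hφ : Continuous φ) (hK : IsClosed K)
    (hsc : ∀ y, IsScattered (K ∩ φ ⁻¹' {y}))
    (hconst : ∀ g : C(X, ℂ),
      {y | ∃ x₁ ∈ K, ∃ x₂ ∈ K, φ x₁ = y ∧ φ x₂ = y ∧ g x₁ ≠ g x₂}.Countable)
    {U : Set X} (hU : IsOpen U) (hUK : U ⊆ K) (hUu : U ≠ Set.univ)
    (hUS : (U ∩ silovBoundary A).Nonempty) :
    ∃ q : (ℕ → Bool) → X, Continuous q ∧ q.Injective ∧ ∀ b, q b ∈ U := by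
  let Node : Type _ := {W : Set X // IsOpen W ∧ W ⊆ U ∧ (W ∩ silovBoundary A).Nonempty}
  have hfork : ∀ (W : Node) (k : ℕ), ∃ V : Bool → Node, (∀ i, closure (V i).1 ⊆ W.1 ∧
      (∀ x ∈ (V i).1, ∀ x' ∈ (V i).1, dist (φ x) (φ x') < 1 / (k + 1)) ∧
      (splitValues A K φ k (V i).1).Countable) ∧
      Disjoint (φ '' (V true).1) (φ '' (V false).1) := by
    rintro ⟨W, hW, hWU, hWS⟩ k
    obtain ⟨V, hV, hVd⟩ := exists_fork hA hAc hAi hφ hK hsc hconst hW (hWU.trans hUK)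
      (fun h => hUu (Set.univ_subset_iff.mp (h ▸ hWU))) hWS k
    exact ⟨fun i => ⟨V i, (hV i).1, subset_closure.trans ((hV i).2.1.trans hWU), (hV i).2.2.1⟩,
      fun i => ⟨(hV i).2.1, (hV i).2.2.2⟩, hVd⟩
  choose step hstep hdisj using hfork
  -- Lists hold the latest choice first, matching `PiNat.res`; the list length supplies the index k
  -- of the fork.
  let T : List Bool → Node := fun s =>
    List.rec ⟨U, hU, subset_rfl, hUS⟩ (fun i s W => step W s.length i) s
  have hT : ∀ i s, T (i :: s) = step (T s) s.length i := fun _ _ => rfl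
  let C : (ℕ → Bool) → ℕ → Set X := fun b n => closure (T (PiNat.res b n)).1
  have hCsub : ∀ b n, C b (n + 1) ⊆ (T (PiNat.res b n)).1 := fun b n => by
    simp only [C, PiNat.res_succ, hT]
    exact (hstep _ _ _).1
  have hCanti : ∀ b, Antitone (C b) := fun b =>
    antitone_nat_of_succ_le fun n => (hCsub b n).trans subset_closure
  have hCne : ∀ b, (⋂ n, C b n).Nonempty := fun b =>
    IsCompact.nonempty_iInter_of_sequence_nonempty_isCompact_isClosed _
      (fun n => hCanti b n.le_succ)
      (fun n => ((T (PiNat.res b n)).2.2.2.mono Set.inter_subset_left).mono subset_closure)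
      isClosed_closure.isCompact fun n => isClosed_closure
  have hCT : ∀ b n x, x ∈ ⋂ n, C b n → x ∈ (T (PiNat.res b n)).1 := fun b n x hx =>
    hCsub b n (Set.mem_iInter.mp hx (n + 1))
  have hCU : ∀ b x, x ∈ ⋂ n, C b n → x ∈ U := fun b x hx => hCT b 0 x hx
  have hφC : ∀ b x x', x ∈ ⋂ n, C b n → x' ∈ ⋂ n, C b n → φ x = φ x' := by
    intro b x x' hx hx'
    refine eq_of_forall_dist_le fun ε hε => ?_
    obtain ⟨n, hn⟩ := exists_nat_one_div_lt hε
    have h1 := hCT b (n + 1) x hx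
    have h2 := hCT b (n + 1) x' hx'
    rw [PiNat.res_succ, hT] at h1 h2
    have h3 := (hstep _ _ _).2.1 x h1 x' h2
    rw [PiNat.res_length] at h3
    exact (h3.trans hn).le
  have hφne : ∀ b b' x x', b ≠ b' → x ∈ ⋂ n, C b n → x' ∈ ⋂ n, C b' n → φ x ≠ φ x' := by
    intro b b' x x' hbb hx hx' heq
    have hres : PiNat.res b (PiNat.firstDiff b b') = PiNat.res b' (PiNat.firstDiff b b') :=
      PiNat.res_eq_res.mpr fun {_} hm => PiNat.apply_eq_of_lt_firstDiff hm
    have hne := PiNat.apply_firstDiff_ne hbb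
    have h1 := hCT b (PiNat.firstDiff b b' + 1) x hx
    have h2 := hCT b' (PiNat.firstDiff b b' + 1) x' hx'
    rw [PiNat.res_succ, hT] at h1 h2
    rw [← hres] at h2
    have hd := hdisj (T (PiNat.res b (PiNat.firstDiff b b')))
      (PiNat.res b (PiNat.firstDiff b b')).length
    cases hb : b (PiNat.firstDiff b b') <;> cases hb' : b' (PiNat.firstDiff b b') <;>
      rw [hb] at h1 <;> rw [hb'] at h2
    · exact hne (hb.trans hb'.symm)
    · exact Set.disjoint_left.mp hd ⟨x', h2, rfl⟩ ⟨x, h1, heq⟩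
    · exact Set.disjoint_left.mp hd ⟨x, h1, rfl⟩ ⟨x', h2, heq.symm⟩
    · exact hne (hb.trans hb'.symm)
  choose p hp using hCne
  have hpinj : Function.Injective fun b => φ (p b) := fun b b' h => by
    by_contra hne
    exact hφne b b' _ _ hne (hp b) (hp b') h
  -- A branch with two limit points has its φ-value among the split values of some node. There are
  -- countably many nodes, each with countably many such values, and φ ∘ p is injective.
  have hbad : {b | ¬ (⋂ n, C b n).Subsingleton}.Countable := by
    have hc : (⋃ s : List Bool, ⋃ i, splitValues A K φ s.length (T (i :: s)).1).Countable :=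
      Set.countable_iUnion fun s => Set.countable_iUnion fun i => (hstep _ _ _).2.2
    refine Set.countable_of_injective_of_countable_image hpinj.injOn (hc.mono ?_)
    rintro _ ⟨b, hb, rfl⟩
    have hb' : ¬ (⋂ n, C b n).Subsingleton := hb
    rw [Set.not_subsingleton_iff] at hb'
    obtain ⟨x, hx, x', hx', hne⟩ := hb'
    obtain ⟨k, hk⟩ := exists_mem_splitValues hA hφ hK hsc (hUK (hCU b x hx)) (hUK (hCU b x' hx'))
      hne (hφC b x x' hx hx')
    refine Set.mem_iUnion₂.mpr ⟨PiNat.res b k, b k, ?_⟩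
    rw [PiNat.res_length]
    change φ (p b) ∈ _
    rw [hφC b _ x (hp b) hx]
    exact hk _ (hCT b (k + 1) x hx) (hCT b (k + 1) x' hx')
  obtain ⟨J, hJc, hJi, hJ⟩ := exists_interleaving_notMem hbad
  refine ⟨fun b => p (J b), ?_, fun b b' h => hJi (hpinj (congrArg φ h)), fun b => hCU _ _ (hp _)⟩
  rw [continuous_iff_continuousAt]
  intro b
  have hsub : (⋂ n, C (J b) n).Subsingleton := not_not.mp (hJ b)
  rw [ContinuousAt, tendsto_nhds]
  intro O hO hbO
  -- On a good branch the sets C shrink to one point, so some C lies in O; all branches in the same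
  -- cylinder end there.
  obtain ⟨n, hn⟩ := exists_subset_nhds_of_isCompact' (hCanti (J b)).directed_ge
    (fun n => isClosed_closure.isCompact) (fun n => isClosed_closure) (U := O)
    (fun x hx => hsub hx (hp (J b)) ▸ hO.mem_nhds hbO)
  have hcyl : J ⁻¹' PiNat.cylinder (J b) n ∈ 𝓝 b :=
    ((PiNat.isOpen_cylinder _ _ _).preimage hJc).mem_nhds (PiNat.self_mem_cylinder _ _)
  filter_upwards [hcyl] with b' hb'
  refine hn ?_
  have hres : PiNat.res (J b') n = PiNat.res (J b) n :=
    PiNat.res_eq_res.mpr fun {m} hm => hb' m hm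
  have := Set.mem_iInter.mp (hp (J b')) n
  simp only [C, hres] at this
  exact this

end Tree

end FunctionAlgebra

theorem mainTheorem3 (H : Type u) [TopologicalSpace H] [CompactSpace H] [T2Space H]
    (hnice : FunctionAlgebra.IsNice H)
    (hcantor : ¬ FunctionAlgebra.ContainsCantorSubset H) :
    FunctionAlgebra.IsRemovable.{u, v} H := by
  intro X _ _ _ U A hU hUu ⟨L, ⟨i⟩⟩ hA hAc hAi x hxS hxU
  have : CompactSpace (closure U) := isCompact_iff_compactSpace.mp isClosed_closure.isCompact
  have hι : Topology.IsClosedEmbedding fun z : closure U => (i z : H) :=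
    (continuous_subtype_val.comp i.continuous).isClosedEmbedding
      (Subtype.val_injective.comp i.injective)
  obtain ⟨φ, hsc, hconst⟩ := hnice.exists_fibre_map isClosed_closure hι
  -- Any metric compatible with the product topology serves.
  let : MetricSpace (ℕ → ℂ) := TopologicalSpace.metrizableSpaceMetric (ℕ → ℂ)
  obtain ⟨q, hq, hqi, hqU⟩ := FunctionAlgebra.exists_cantor_embedding hA hAc hAi φ.continuous
    isClosed_closure hsc hconst hU subset_closure hUu ⟨x, hxU, hxS⟩
  have hemb : Topology.IsClosedEmbedding fun b => (i ⟨q b, subset_closure (hqU b)⟩ : H) :=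
    (hι.continuous.comp (hq.subtype_mk _)).isClosedEmbedding
      (hι.injective.comp fun b b' h => hqi (congrArg Subtype.val h))
  exact hcantor ⟨_, ⟨hemb.isEmbedding.toHomeomorph.symm.trans cantorSetHomeomorphNatToBool.symm⟩⟩
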